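/- \textbf{Setting.} Let $\mathcal H=\bigotimes_{i=1}^N\mathcal H_i$ with $\mathcal H_i\simeq\mathbb C^{d_i}$, let $\mathcal N=(\mathcal N_1,\dots,\mathcal N_K)$ be a list of subsets (neighborhoods) of $\{1,\dots,N\}$, let $|\psi\rangle\in\mathcal H$ be a unit vector and $\rho=|\psi\rangle\langle\psi|$. For a set $S$ of sites put $\mathcal H_S=\bigotimes_{i\in S}\mathcal H_i$ and let $\overline S$ be its complement. A \emph{neighborhood map} is a CPTP map of the form $\mathcal F\otimes\mathrm{id}_{\overline{\mathcal N}_k}$ for some $k$, with $\mathcal F$ a CPTP map on $\mathcal B(\mathcal H_{\mathcal N_k})$. $\bullet$ $|\psi\rangle$ is \emph{QLS} if there is a sequence $(\mathcal E_t)_{t\ge 0}$ of neighborhood maps with $\mathcal E_t(\rho)=\rho$ for all $t$ and $\lim_{t\to\infty}\mathcal E_{t-1}\circ\dots\circ\mathcal E_s(\sigma)=\rho$ for every density operator $\sigma$ and every $s\ge 0$. $\bullet$ $|\psi\rangle$ is \emph{RFTS} if there is a finite sequence $\mathcal E_1,\dots,\mathcal E_T$ of neighborhood maps with $\mathcal E_t(\rho)=\rho$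 for all $t$, such that $T$ is the smallest integer with $\mathcal E_T\circ\dots\circ\mathcal E_1(\sigma)=\rho$ for all density operators $\sigma$, and such that $\mathcal E_{\pi(T)}\circ\dots\circ\mathcal E_{\pi(1)}(\sigma)=\rho$ for all density operators $\sigma$ and every permutation $\pi$. $\bullet$ $\Pi_k=\Pi_{\mathcal N_k}\otimes\mathbb I_{\overline{\mathcal N}_k}$, where $\Pi_{\mathcal N_k}$ is the orthogonal projector onto the Schmidt span of $|\psi\rangle$ in $\mathcal H_{\mathcal N_k}$ (the span of the left vectors of a Schmidt decomposition of $|\psi\rangle$ in $\mathcal H_{\mathcal N_k}\otimes\mathcal H_{\overline{\mathcal N}_k}$). $\bullet$ Let $\tilde{\mathcal H}_i=\operatorname{supp}(\operatorname{tr}_{\overline i}\rho)$, $\tilde{\mathcal H}_S=\bigotimes_{i\in S}\tilde{\mathcal H}_i$, and let $\tilde{\mathcal H}=\bigotimes_{i=1}^N\tilde{\mathcal H}_i$ be the local support space of $\rho$, with $\mathcal H=\mathcal H^0\oplus\tilde{\mathcal H}$, $\mathcal H^0=\tilde{\mathcal H}^\perp$. $\bullet$ The \emph{neighborhood algebra}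 $\mathcal A_j$ is the set of all $(c\,\mathbb I\oplus X)\otimes\mathbb I_{\overline{\mathcal N}_j}$, relative to $\mathcal H_{\mathcal N_j}=(\tilde{\mathcal H}_{\mathcal N_j})^\perp\oplus\tilde{\mathcal H}_{\mathcal N_j}$, with $c\in\mathbb C$ and $X\in\mathcal B(\tilde{\mathcal H}_{\mathcal N_j})$ such that $X\otimes\mathbb I_{\tilde{\mathcal H}_{\overline{\mathcal N}_j}}$ commutes on $\tilde{\mathcal H}$ with $\Pi_k|_{\tilde{\mathcal H}}$ for all $k\neq j$. \textbf{Theorem (Algebraic factorization RFTS).} Let $|\psi\rangle$ be QLS with respect to $\mathcal N$, and let the restrictions $\mathcal A_j|_{\tilde{\mathcal H}}$ be commuting (elements of $\mathcal A_j|_{\tilde{\mathcal H}}$ and $\mathcal A_k|_{\tilde{\mathcal H}}$ commute for $j\ne k$) and complete (their union generates $\mathcal B(\tilde{\mathcal H})$). Then: (1) There are finite-dimensional Hilbert spaces $\hat{\mathcal H}_1,\dots,\hat{\mathcal H}_K$ and a unitary $W:\tilde{\mathcal H}\to\bigotimes_{j=1}^K\hat{\mathcal H}_j$ that is induced by the neighborhood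 algebras, i.e. $W\,\mathcal A_j|_{\tilde{\mathcal H}}\,W^{-1}=\mathcal B(\hat{\mathcal H}_j)\otimes\mathbb I_{\overline j}$ for every $j$. (2) For every such induced factorization there are unit vectors $|\hat\psi_j\rangle\in\hat{\mathcal H}_j$ with $|\psi\rangle=0\oplus W^{-1}\bigotimes_{j}|\hat\psi_j\rangle\in\mathcal H^0\oplus\tilde{\mathcal H}$. (3) $|\psi\rangle$ is RFTS with respect to $\mathcal N$. -/

import Mathlib

open Filter Topology
open scoped Matrix Kronecker ComplexOrder

noncomputable section

namespace QuasiLocal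

/-! ### Vectors, operators, states -/

/-- The finite-dimensional Hilbert space with orthonormal basis indexed by `n`. -/
abbrev Hilb (n : Type) : Type := EuclideanSpace ℂ n

/-- The operators on `Hilb n`, as matrices in the standard basis. -/
abbrev Op (n : Type) : Type := Matrix n n ℂ

/-- The action of an operator on vectors. -/
abbrev act {n : Type} [Fintype n] [DecidableEq n] (X : Op n) : Hilb n →ₗ[ℂ] Hilb n :=
  Matrix.toEuclideanLin X

/-- Density operators. -/
def IsDensity {n : Type} [Fintype n] (ρ : Op n) : Prop :=
  ρ.PosSemidef ∧ ρ.trace = 1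

/-- The operator `|ψ⟩⟨ψ|`. -/
def ketbra {n : Type} (ψ : Hilb n) : Op n :=
  Matrix.of fun a b => ψ a * star (ψ b)

/-- The orthogonal projector onto a subspace, as a matrix. -/
def proj {n : Type} [Fintype n] [DecidableEq n] (K : Submodule ℂ (Hilb n)) : Op n :=
  Matrix.toEuclideanLin.symm (K.starProjection : Hilb n →ₗ[ℂ] Hilb n)

/-- Completely positive trace-preserving maps (in Kraus form). -/
def IsCPTP {n : Type} [Fintype n] [DecidableEq n] (F : Op n →ₗ[ℂ] Op n) : Prop :=
  ∃ (r : ℕ) (Kr : Fin r → Op n),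
    ∑ a, (Kr a)ᴴ * Kr a = 1 ∧ ∀ M, F M = ∑ a, Kr a * M * (Kr a)ᴴ

/-! ### Bipartite systems

A bipartition `Hilb C ≃ Hilb A ⊗ Hilb B` is given by a bijection `e : C ≃ A × B` of the standard
(product) basis. -/

/-- The operator `X ⊗ 𝕀`. -/
def ampliate {A B C : Type} [DecidableEq B] (e : C ≃ A × B) (X : Op A) : Op C :=
  (X ⊗ₖ (1 : Op B)).submatrix e e

/-- The partial trace over the second factor. -/
def partialTrace {A B C : Type} [Fintype B] (e : C ≃ A × B) (M : Op C) : Op A :=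
  Matrix.of fun a a' => ∑ b, M (e.symm (a, b)) (e.symm (a', b))

/-- `E = F ⊗ id`, as maps on operators. -/
def IsTensorId {A B C : Type} (e : C ≃ A × B) (E : Op C →ₗ[ℂ] Op C) (F : Op A →ₗ[ℂ] Op A) :
    Prop :=
  ∀ (M : Op C) (a a' : A) (b b' : B), E M (e.symm (a, b)) (e.symm (a', b')) =
    F (Matrix.of fun x x' => M (e.symm (x, b)) (e.symm (x', b'))) a a'

/-- The vector `(𝕀 ⊗ ⟨b|) ψ` of the first factor. -/
def slice {A B C : Type} (e : C ≃ A × B) (ψ : Hilb C) (b : B) : Hilb A :=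
  WithLp.toLp 2 fun a => ψ (e.symm (a, b))

/-- The Schmidt span of `ψ` with respect to the first factor, i.e. the column space of its
coefficient matrix. `schmidtSpan_eq` below identifies it with the span of the left
vectors of any Schmidt decomposition of `ψ`. -/
def schmidtSpan {A B C : Type} (e : C ≃ A × B) (ψ : Hilb C) : Submodule ℂ (Hilb A) :=
  Submodule.span ℂ (Set.range (slice e ψ))

theorem schmidtSpan_eq {A B C : Type} [Fintype A] [Fintype B] (e : C ≃ A × B) (ψ : Hilb C)
    {r : ℕ} (s : Fin r → ℝ) (hs : ∀ i, 0 < s i) (u : Fin r → Hilb A) (w : Fin r → Hilb B)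
    (hw : Orthonormal ℂ w)
    (h : ∀ a b, ψ (e.symm (a, b)) = ∑ i, (s i : ℂ) * (u i a * w i b)) :
    schmidtSpan e ψ = Submodule.span ℂ (Set.range u) := by
  apply le_antisymm
  · refine Submodule.span_le.2 ?_
    rintro _ ⟨b, rfl⟩
    have : slice e ψ b = ∑ i, ((s i : ℂ) * w i b) • u i := by
      ext a
      simp only [slice, h, PiLp.toLp_apply, WithLp.ofLp_sum, WithLp.ofLp_smul, Finset.sum_apply, Pi.smul_apply, smul_eq_mul]
      exact Finset.sum_congr rfl fun i _ => by ring
    rw [this]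
    exact Submodule.sum_mem _ fun i _ =>
      Submodule.smul_mem _ _ (Submodule.subset_span ⟨i, rfl⟩)
  · refine Submodule.span_le.2 ?_
    rintro _ ⟨j, rfl⟩
    have hw' : ∀ i, ∑ b, star (w j b) * w i b = if j = i then 1 else 0 := by
      intro i
      have := (orthonormal_iff_ite.1 hw) j i
      simpa [PiLp.inner_apply, mul_comm] using this
    have : u j = ((s j : ℂ)⁻¹) • ∑ b, star (w j b) • slice e ψ b := by
      ext a
      have h1 : ∑ b, star (w j b) * ψ (e.symm (a, b)) = (s j : ℂ) * u j a := by
        calc ∑ b, star (w j b) * ψ (e.symm (a, b))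
            = ∑ i, (s i : ℂ) * u i a * ∑ b, star (w j b) * w i b := by
              simp only [h, Finset.mul_sum]
              rw [Finset.sum_comm]
              refine Finset.sum_congr rfl fun i _ => Finset.sum_congr rfl fun b _ => ?_
              ring
          _ = (s j : ℂ) * u j a := by simp only [hw']; simp
      have h2 : (s j : ℂ) ≠ 0 := by exact_mod_cast (hs j).ne'
      have h3 : u j a = (s j : ℂ)⁻¹ * ∑ b, star (w j b) * ψ (e.symm (a, b)) := by
        rw [h1, inv_mul_cancel_left₀ h2]
      simpa [slice] using h3
    rw [this]
    exact Submodule.smul_mem _ _ (Submodule.sum_mem _ fun b _ =>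
      Submodule.smul_mem _ _ (Submodule.subset_span ⟨b, rfl⟩))

/-! ### Multipartite systems -/

/-- The product basis of `⨂ i, ℂ^(d i)`; the multipartite space itself is `Hilb (Cfg d)`. -/
abbrev Cfg {ι : Type} (d : ι → ℕ) : Type := ∀ i, Fin (d i)

/-- The product vector `⨂ i, v i`. -/
def prodVec {ι : Type} [Fintype ι] {d : ι → ℕ} (v : ∀ i, Hilb (Fin (d i))) : Hilb (Cfg d) :=
  WithLp.toLp 2 fun x => ∏ i, v i (x i)

/-- The subspace `⨂ i, L i` of `⨂ i, ℂ^(d i)`. -/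
def tensorSubspace {ι : Type} [Fintype ι] {d : ι → ℕ}
    (L : ∀ i, Submodule ℂ (Hilb (Fin (d i)))) : Submodule ℂ (Hilb (Cfg d)) :=
  Submodule.span ℂ {w | ∃ v : ∀ i, Hilb (Fin (d i)), (∀ i, v i ∈ L i) ∧ w = prodVec v}

/-- The bipartition of a multipartite system into one factor and all the others. -/
abbrev single {ι : Type} [DecidableEq ι] (d : ι → ℕ) (i : ι) :
    Cfg d ≃ Fin (d i) × Cfg (fun j : {j // j ≠ i} => d j) :=
  Equiv.piSplitAt i fun j => Fin (d j)

/-- The product basis of the subsystem formed by the sites in `S`. -/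
abbrev SubCfg {N : ℕ} (d : Fin N → ℕ) (S : Finset (Fin N)) : Type :=
  Cfg (fun i : {i // i ∈ S} => d i)

/-- The bipartition into the sites in `S` and the sites outside `S`. -/
abbrev split {N : ℕ} (d : Fin N → ℕ) (S : Finset (Fin N)) :
    Cfg d ≃ SubCfg d S × Cfg (fun i : {i // ¬ i ∈ S} => d i) :=
  Equiv.piEquivPiSubtypeProd (· ∈ S) fun i => Fin (d i)

/-! ### Quasi-local dynamics and stabilizability -/

/-- CPTP maps of the form `F ⊗ id`, with `F` acting on the sites in `S`. -/
def IsNeighborhoodMap {N : ℕ} (d : Fin N → ℕ) (S : Finset (Fin N))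
    (E : Op (Cfg d) →ₗ[ℂ] Op (Cfg d)) : Prop :=
  ∃ F : Op (SubCfg d S) →ₗ[ℂ] Op (SubCfg d S), IsCPTP F ∧ IsTensorId (split d S) E F

/-- Apply the maps of a list one after the other, the head of the list first. -/
def applyMaps {n : Type} (L : List (Op n →ₗ[ℂ] Op n)) (σ : Op n) : Op n :=
  L.foldl (fun τ E => E τ) σ

/-- `ρ` is invariant and attractive for the dynamics `E 0, E 1, E 2, …`, from any starting
time `s`. -/
def IsGAS {n : Type} [Fintype n] (ρ : Op n) (E : ℕ → Op n →ₗ[ℂ] Op n) : Prop :=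
  (∀ t, E t ρ = ρ) ∧
  ∀ σ, IsDensity σ → ∀ s : ℕ,
    Tendsto (fun k : ℕ => applyMaps ((List.range k).map fun i => E (s + i)) σ) atTop (𝓝 ρ)

/-- Discrete-time quasi-local stabilizability with respect to the neighborhoods `nbhd k`. -/
def IsQLS {N K : ℕ} (d : Fin N → ℕ) (nbhd : Fin K → Finset (Fin N)) (ρ : Op (Cfg d)) : Prop :=
  ∃ E : ℕ → Op (Cfg d) →ₗ[ℂ] Op (Cfg d),
    (∀ t, ∃ k, IsNeighborhoodMap d (nbhd k) (E t)) ∧ IsGAS ρ E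

/-- The maps of the list, applied in order, take every density operator to `ρ`. -/
def Prepares {n : Type} [Fintype n] (L : List (Op n →ₗ[ℂ] Op n)) (ρ : Op n) : Prop :=
  ∀ σ, IsDensity σ → applyMaps L σ = ρ

/-- The sequence `E 0, …, E (T-1)` of neighborhood maps stabilizes `ρ` in (exactly) `T` steps:
every map leaves `ρ` invariant, and `T` is the smallest number of steps after which the
sequence takes every density operator to `ρ`. -/
def StabilizesIn {N K : ℕ} (d : Fin N → ℕ) (nbhd : Fin K → Finset (Fin N)) (ρ : Op (Cfg d))
    (T : ℕ) (E : Fin T → Op (Cfg d) →ₗ[ℂ] Op (Cfg d)) : Prop :=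
  (∀ t, ∃ k, IsNeighborhoodMap d (nbhd k) (E t)) ∧
  (∀ t, E t ρ = ρ) ∧
  Prepares (List.ofFn E) ρ ∧
  ∀ S < T, ¬ Prepares ((List.ofFn E).take S) ρ

/-- Robust finite-time stabilizability: the maps prepare `ρ` in whatever order they are applied. -/
def IsRFTS {N K : ℕ} (d : Fin N → ℕ) (nbhd : Fin K → Finset (Fin N)) (ρ : Op (Cfg d)) : Prop :=
  ∃ (T : ℕ) (E : Fin T → Op (Cfg d) →ₗ[ℂ] Op (Cfg d)), StabilizesIn d nbhd ρ T E ∧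
    ∀ π : Equiv.Perm (Fin T), Prepares (List.ofFn fun t => E (π t)) ρ

/-! ### Local support and neighborhood algebras -/

/-- The projector `Π_S = Π_{Σ_S(ψ)} ⊗ 𝕀` onto the extended Schmidt span of `ψ` on the sites
in `S`. -/
def schmidtProj {N : ℕ} (d : Fin N → ℕ) (ψ : Hilb (Cfg d)) (S : Finset (Fin N)) : Op (Cfg d) :=
  ampliate (split d S) (proj (schmidtSpan (split d S) ψ))

/-- The support of the reduced state of `|ψ⟩⟨ψ|` at the site `i`. -/
def siteSupport {N : ℕ} (d : Fin N → ℕ) (ψ : Hilb (Cfg d)) (i : Fin N) :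
    Submodule ℂ (Hilb (Fin (d i))) :=
  LinearMap.range (act (partialTrace (single d i) (ketbra ψ)))

/-- The local support of `|ψ⟩⟨ψ|`: the tensor product over all sites of the site supports. -/
def localSupport {N : ℕ} (d : Fin N → ℕ) (ψ : Hilb (Cfg d)) : Submodule ℂ (Hilb (Cfg d)) :=
  tensorSubspace fun i => siteSupport d ψ i

/-- The local support of `|ψ⟩⟨ψ|` on the sites in `S`, inside the space of these sites. -/
def localSupportOn {N : ℕ} (d : Fin N → ℕ) (ψ : Hilb (Cfg d)) (S : Finset (Fin N)) :
    Submodule ℂ (Hilb (SubCfg d S)) :=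
  tensorSubspace fun i : {i // i ∈ S} => siteSupport d ψ i

/-- The neighborhood algebra of the `j`-th neighborhood: the operators `X ⊗ 𝕀` with
`X = c 𝕀 ⊕ X'` relative to the orthogonal decomposition of the neighborhood space into the
complement of the local support and the local support, such that `X ⊗ 𝕀` commutes on the local
support of the whole system with every Schmidt-span projector `Π_k`, `k ≠ j`. -/
def neighborhoodAlgebra {N K : ℕ} (d : Fin N → ℕ) (nbhd : Fin K → Finset (Fin N))
    (ψ : Hilb (Cfg d)) (j : Fin K) : Set (Op (Cfg d)) :=
  {A | ∃ X : Op (SubCfg d (nbhd j)),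
    A = ampliate (split d (nbhd j)) X ∧
    (∀ v ∈ localSupportOn d ψ (nbhd j), act X v ∈ localSupportOn d ψ (nbhd j)) ∧
    (∃ c : ℂ, ∀ v ∈ (localSupportOn d ψ (nbhd j))ᗮ, act X v = c • v) ∧
    ∀ k, k ≠ j → ∀ v ∈ localSupport d ψ,
      act A (act (schmidtProj d ψ (nbhd k)) v) = act (schmidtProj d ψ (nbhd k)) (act A v)}

/-- The restrictions to the subspace `L` of the operators in `𝒜` (those that preserve `L`). -/
def restrictTo {n : Type} [Fintype n] [DecidableEq n] (L : Submodule ℂ (Hilb n))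
    (𝒜 : Set (Op n)) : Set (Module.End ℂ L) :=
  {Y | ∃ A ∈ 𝒜, ∀ v : L, (Y v : Hilb n) = act A (v : Hilb n)}

/-- The `j`-th neighborhood algebra, restricted to the local support of `|ψ⟩⟨ψ|`. -/
def restrictedAlgebra {N K : ℕ} (d : Fin N → ℕ) (nbhd : Fin K → Finset (Fin N))
    (ψ : Hilb (Cfg d)) (j : Fin K) : Set (Module.End ℂ (localSupport d ψ)) :=
  restrictTo (localSupport d ψ) (neighborhoodAlgebra d nbhd ψ j)

/-- Elements of different members of the family commute. -/
def IsCommutingFamily {κ R : Type} [Mul R] (𝒜 : κ → Set R) : Prop :=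
  ∀ j k, j ≠ k → ∀ X ∈ 𝒜 j, ∀ Y ∈ 𝒜 k, X * Y = Y * X

/-- The union of the family generates the whole operator algebra. -/
def IsCompleteFamily {κ V : Type} [AddCommGroup V] [Module ℂ V] (𝒜 : κ → Set (Module.End ℂ V)) :
    Prop :=
  Algebra.adjoin ℂ (⋃ j, 𝒜 j) = ⊤

/-- The unitary `W` identifies the local support with `⨂ j, ℂ^(m j)` in such a way that the
`j`-th neighborhood algebra becomes the algebra of all operators on the `j`-th factor. -/
def IsInducedFactorization {N K : ℕ} (d : Fin N → ℕ) (nbhd : Fin K → Finset (Fin N))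
    (ψ : Hilb (Cfg d)) (m : Fin K → ℕ) (W : localSupport d ψ ≃ₗᵢ[ℂ] Hilb (Cfg m)) : Prop :=
  ∀ (j : Fin K) (Y : Module.End ℂ (localSupport d ψ)),
    Y ∈ restrictedAlgebra d nbhd ψ j ↔
      ∃ B : Op (Fin (m j)), ∀ v, W (Y v) = act (ampliate (single m j) B) (W v)

end QuasiLocal

end

open QuasiLocal

/-!
An operator on the local support that commutes with all the algebras `𝒜_k`, `k ≠ j`, lies in `𝒜_j`,
because the algebras commute and are complete. In particular the restricted Schmidt projectors
satisfy `Π_j ∈ 𝒜_j`, and by QLS the vector `ψ` is up to scalars the only one fixed by all of them.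
For `Y ∈ 𝒜_j` the vector `Π_j Y ψ` is fixed by every `Π_k`, so it is `⟨ψ, Y ψ⟩ ψ`. Hence
`⟨X S ψ, Y T ψ⟩ = ⟨X ψ, Y ψ⟩ ⟨S ψ, T ψ⟩` for `X, Y ∈ 𝒜_j` and `S, T` in the other algebras:
products of orthonormal bases of the orbits `𝒜_j ψ` are orthonormal, and by completeness they span
the local support. This is the factorization. In every induced factorization `Π_j` has rank one on
the `j`-th factor, so `ψ` is a product `⨂ φ_j` there.

For RFTS, each neighborhood first resets its sites to their local supports and then resets its own
virtual factor to `φ_j`. The second stage is conditioned on the local support, where the Kraus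
operators of different neighborhoods commute. The resulting maps commute as maps on all operators,
fix `ψ`, and have outputs supported on the range of `Π_j`; in any order they hence leave only `ψ`.
-/

noncomputable section

namespace QuasiLocal

/-! ### Operators -/

section Operators

variable {n : Type} [Fintype n] [DecidableEq n]

theorem act_apply (X : Op n) (v : Hilb n) (a : n) : act X v a = ∑ b, X a b * v b := by
  simp [act, Matrix.mulVec, dotProduct]

theorem act_mul (X Y : Op n) (v : Hilb n) : act (X * Y) v = act X (act Y v) := by
  simp [act]

theorem act_one (v : Hilb n) : act (1 : Op n) v = v := by
  simp [act]

theorem act_add (X Y : Op n) (v : Hilb n) : act (X + Y) v = act X v + act Y v := by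
  simp only [act, map_add, LinearMap.add_apply]

theorem act_sub (X Y : Op n) (v : Hilb n) : act (X - Y) v = act X v - act Y v := by
  simp only [act, map_sub, LinearMap.sub_apply]

theorem act_smul (c : ℂ) (X : Op n) (v : Hilb n) : act (c • X) v = c • act X v := by
  simp only [act, map_smul, LinearMap.smul_apply]

theorem act_sum {α : Type} (s : Finset α) (X : α → Op n) (v : Hilb n) :
    act (∑ a ∈ s, X a) v = ∑ a ∈ s, act (X a) v := by
  simp only [act, map_sum, LinearMap.sum_apply]

theorem op_ext {X Y : Op n} (h : ∀ v, act X v = act Y v) : X = Y :=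
  Matrix.toEuclideanLin.injective (LinearMap.ext h)

theorem inner_act_right (X : Op n) (v w : Hilb n) :
    inner ℂ v (act X w) = inner ℂ (act Xᴴ v) w := by
  rw [act, act, Matrix.toEuclideanLin_conjTranspose_eq_adjoint, LinearMap.adjoint_inner_left]

theorem inner_act_left (X : Op n) (v w : Hilb n) :
    inner ℂ (act X v) w = inner ℂ v (act Xᴴ w) := by
  rw [inner_act_right, Matrix.conjTranspose_conjTranspose]

theorem act_comm_of_commute {X Y : Op n} (h : Commute X Y) (v : Hilb n) :
    act X (act Y v) = act Y (act X v) := by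
  rw [← act_mul, h.eq, act_mul]

theorem act_proj_mem (K : Submodule ℂ (Hilb n)) (v : Hilb n) : act (proj K) v ∈ K := by
  simp [act, proj]

theorem act_proj_eq_self_iff {K : Submodule ℂ (Hilb n)} {v : Hilb n} :
    act (proj K) v = v ↔ v ∈ K := by
  simp [act, proj, Submodule.starProjection_eq_self_iff]

theorem proj_mul_self (K : Submodule ℂ (Hilb n)) : proj K * proj K = proj K :=
  op_ext fun v => by rw [act_mul, act_proj_eq_self_iff]; exact act_proj_mem K v

theorem conjTranspose_proj (K : Submodule ℂ (Hilb n)) : (proj K)ᴴ = proj K :=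
  op_ext fun v => ext_inner_right ℂ fun w => by
    simpa [← inner_act_right, act, proj] using (K.starProjection_isSymmetric v w).symm

/-- The vectors fixed by an operator. For a projector this is its range. -/
def fixedSpace (X : Op n) : Submodule ℂ (Hilb n) := LinearMap.eqLocus (act X) LinearMap.id

theorem mem_fixedSpace {X : Op n} {v : Hilb n} : v ∈ fixedSpace X ↔ act X v = v := Iff.rfl

/-- The matrix unit `|τ⟩⟨c|`, with `c` a vector of the standard basis. -/
def ketBasis (τ : Hilb n) (c : n) : Op n := Matrix.vecMulVec τ (Pi.single c 1)

theorem act_ketBasis (τ : Hilb n) (c : n) (v : Hilb n) : act (ketBasis τ c) v = v c • τ := by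
  ext a
  rw [act_apply]
  simp [ketBasis, Matrix.vecMulVec_apply, Pi.single_apply, mul_comm]

theorem sum_conjTranspose_ketBasis_mul {τ : Hilb n} (hτ : ‖τ‖ = 1) :
    ∑ c, (ketBasis τ c)ᴴ * ketBasis τ c = 1 := by
  refine op_ext fun v => ext_inner_left ℂ fun w => ?_
  simp only [act_sum, act_mul, act_one, inner_sum, ← inner_act_left, act_ketBasis,
    inner_smul_left, inner_smul_right, inner_self_eq_norm_sq_to_K, hτ]
  simp [PiLp.inner_apply, mul_comm]

end Operators

/-! ### Bipartite systems -/

section Bipartite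

variable {A B C : Type}

theorem slice_apply (e : C ≃ A × B) (v : Hilb C) (b : B) (a : A) :
    slice e v b a = v (e.symm (a, b)) := rfl

theorem slice_ext (e : C ≃ A × B) {v w : Hilb C} (h : ∀ b, slice e v b = slice e w b) : v = w := by
  ext x
  simpa [slice_apply] using congrArg (fun u : Hilb A => u (e x).1) (h (e x).2)

theorem slice_smul (e : C ≃ A × B) (c : ℂ) (v : Hilb C) (b : B) :
    slice e (c • v) b = c • slice e v b := rfl

theorem ampliate_apply [DecidableEq B] (e : C ≃ A × B) (X : Op A) (x y : C) :
    ampliate e X x y = X (e x).1 (e y).1 * if (e x).2 = (e y).2 then 1 else 0 := by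
  simp [ampliate, Matrix.one_apply]

theorem ampliate_add [DecidableEq B] (e : C ≃ A × B) (X Y : Op A) :
    ampliate e (X + Y) = ampliate e X + ampliate e Y := by
  rw [ampliate, Matrix.add_kronecker]; rfl

theorem ampliate_sub [DecidableEq B] (e : C ≃ A × B) (X Y : Op A) :
    ampliate e (X - Y) = ampliate e X - ampliate e Y := by
  ext; simp [ampliate, sub_mul]

theorem ampliate_smul [DecidableEq B] (e : C ≃ A × B) (c : ℂ) (X : Op A) :
    ampliate e (c • X) = c • ampliate e X := by
  rw [ampliate, Matrix.smul_kronecker]; rfl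

theorem ampliate_sum [DecidableEq B] (e : C ≃ A × B) {α : Type} (s : Finset α) (X : α → Op A) :
    ampliate e (∑ a ∈ s, X a) = ∑ a ∈ s, ampliate e (X a) := by
  ext; simp [ampliate, Matrix.sum_apply, Finset.sum_mul]

theorem ampliate_conjTranspose [DecidableEq B] (e : C ≃ A × B) (X : Op A) :
    ampliate e Xᴴ = (ampliate e X)ᴴ := by
  rw [ampliate, ampliate, Matrix.conjTranspose_submatrix, Matrix.conjTranspose_kronecker,
    Matrix.conjTranspose_one]

theorem ampliate_one [DecidableEq A] [DecidableEq B] [DecidableEq C] (e : C ≃ A × B) :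
    ampliate e (1 : Op A) = 1 := by
  rw [ampliate, Matrix.one_kronecker_one, Matrix.submatrix_one_equiv]

theorem ampliate_injective [DecidableEq B] [Nonempty B] (e : C ≃ A × B) :
    Function.Injective (ampliate (B := B) e) := by
  intro X Y h
  obtain ⟨b⟩ := ‹Nonempty B›
  ext a a'
  simpa [ampliate_apply] using congrFun₂ h (e.symm (a, b)) (e.symm (a', b))

variable [Fintype A] [Finite B] [Fintype C] [DecidableEq B] (e : C ≃ A × B)

theorem ampliate_mul (X Y : Op A) : ampliate e (X * Y) = ampliate e X * ampliate e Y := by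
  have := Fintype.ofFinite B
  rw [ampliate, ampliate, ampliate, Matrix.submatrix_mul_equiv, ← Matrix.mul_kronecker_mul,
    one_mul]

variable [DecidableEq A] [DecidableEq C]

theorem slice_act_ampliate (X : Op A) (v : Hilb C) (b : B) :
    slice e (act (ampliate e X) v) b = act X (slice e v b) := by
  have := Fintype.ofFinite B
  ext a
  rw [slice_apply, act_apply, act_apply, ← Equiv.sum_comp e.symm, Fintype.sum_prod_type]
  simp [ampliate_apply, slice_apply]

theorem act_ampliate_proj_eq_self_iff {K : Submodule ℂ (Hilb A)} {v : Hilb C} :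
    act (ampliate e (proj K)) v = v ↔ ∀ b, slice e v b ∈ K := by
  refine ⟨fun h b => ?_, fun h => slice_ext e fun b => ?_⟩
  · rw [← h, slice_act_ampliate]
    exact act_proj_mem _ _
  · rw [slice_act_ampliate, act_proj_eq_self_iff]
    exact h b

end Bipartite

theorem eq_zero_of_act_ampliate_ketBasis {A B C : Type} [Finite A] [Finite B] [Fintype C]
    [DecidableEq A] [DecidableEq B] [DecidableEq C] (e : C ≃ A × B) {τ : Hilb A} (hτ : τ ≠ 0)
    {v : Hilb C} (h : ∀ c, act (ampliate e (ketBasis τ c)) v = 0) : v = 0 := by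
  have := Fintype.ofFinite A
  ext x
  have hx : slice e (act (ampliate e (ketBasis τ (e x).1)) v) (e x).2 = 0 := by rw [h]; rfl
  rw [slice_act_ampliate, act_ketBasis, smul_eq_zero_iff_left hτ] at hx
  simpa [slice_apply] using hx

/-! ### Multipartite systems -/

section Multipartite

variable {ι : Type} {d : ι → ℕ}

theorem single_symm_apply_eq_update [DecidableEq ι] (i : ι) (x : Cfg d) (a : Fin (d i)) :
    (single d i).symm (a, (single d i x).2) = Function.update x i a := by
  rw [Equiv.symm_apply_eq]
  refine Prod.ext (by simp) ?_
  funext j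
  simp [Function.update_of_ne j.2]

variable [Fintype ι]

theorem prodVec_apply (v : ∀ i, Hilb (Fin (d i))) (x : Cfg d) :
    prodVec v x = ∏ i, v i (x i) := rfl

theorem prodVec_single_one (x : Cfg d) :
    prodVec (fun i => EuclideanSpace.single (x i) (1 : ℂ)) = EuclideanSpace.single x 1 := by
  ext y
  rw [prodVec_apply]
  simp only [PiLp.single_apply, Finset.prod_ite_zero, funext_iff]
  simp

variable [DecidableEq ι]

theorem norm_prodVec (v : ∀ i, Hilb (Fin (d i))) : ‖prodVec v‖ = ∏ i, ‖v i‖ := by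
  simp only [EuclideanSpace.norm_eq]
  rw [← Real.sqrt_prod _ fun i _ => Finset.sum_nonneg fun a _ => sq_nonneg _,
    Finset.prod_univ_sum]
  simp [prodVec_apply, Finset.prod_pow]

theorem act_ampliate_single (i : ι) (X : Op (Fin (d i))) (v : Hilb (Cfg d)) (x : Cfg d) :
    act (ampliate (single d i) X) v x = ∑ a, X (x i) a * v (Function.update x i a) := by
  have h := congrArg (fun u : Hilb (Fin (d i)) => u (x i))
    (slice_act_ampliate (single d i) X v (single d i x).2)
  simpa only [slice_apply, act_apply (X := X), single_symm_apply_eq_update,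
    Function.update_eq_self] using h

theorem act_ampliate_single_prodVec (i : ι) (X : Op (Fin (d i))) (v : ∀ i, Hilb (Fin (d i))) :
    act (ampliate (single d i) X) (prodVec v) = prodVec (Function.update v i (act X (v i))) := by
  ext x
  have hrest : ∀ (w : Hilb (Fin (d i))) (a : Fin (d i)),
      prodVec (Function.update v i w) (Function.update x i a) =
        w a * ∏ j ∈ Finset.univ.erase i, v j (x j) := fun w a => by
    rw [prodVec_apply, ← Finset.mul_prod_erase _ _ (Finset.mem_univ i), Function.update_self,
      Function.update_self]
    congr 1
    refine Finset.prod_congr rfl fun j hj => ?_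
    rw [Function.update_of_ne (Finset.ne_of_mem_erase hj),
      Function.update_of_ne (Finset.ne_of_mem_erase hj)]
  have hx := hrest (act X (v i)) (x i)
  rw [Function.update_eq_self] at hx
  rw [act_ampliate_single, hx, act_apply, Finset.sum_mul]
  refine Finset.sum_congr rfl fun a _ => ?_
  have ha := hrest (v i) a
  rw [Function.update_eq_self] at ha
  rw [ha, mul_assoc]

theorem mem_span_prodVec_of_act_eq_self {L : ∀ i, Submodule ℂ (Hilb (Fin (d i)))}
    {v : Hilb (Cfg d)} {s : Finset ι}
    (h : ∀ i ∈ s, act (ampliate (single d i) (proj (L i))) v = v) :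
    v ∈ Submodule.span ℂ
      {w | ∃ u : ∀ i, Hilb (Fin (d i)), (∀ i ∈ s, u i ∈ L i) ∧ w = prodVec u} := by
  induction s using Finset.induction with
  | empty =>
    rw [← (EuclideanSpace.basisFun (Cfg d) ℂ).sum_repr v]
    refine Submodule.sum_mem _ fun x _ => Submodule.smul_mem _ _ (Submodule.subset_span ?_)
    exact ⟨_, by simp, by rw [EuclideanSpace.basisFun_apply, prodVec_single_one]⟩
  | insert i s _ ih =>
    rw [← h i (Finset.mem_insert_self i s)]
    have himage := Submodule.mem_map_of_mem (f := act (ampliate (single d i) (proj (L i))))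
      (ih fun j hj => h j (Finset.mem_insert_of_mem hj))
    rw [Submodule.map_span] at himage
    refine Submodule.span_mono ?_ himage
    rintro _ ⟨_, ⟨u, hu, rfl⟩, rfl⟩
    refine ⟨_, fun k hk => ?_, act_ampliate_single_prodVec _ _ _⟩
    rcases eq_or_ne k i with rfl | hki
    · rw [Function.update_self]
      exact act_proj_mem _ _
    · rw [Function.update_of_ne hki]
      exact hu k (Finset.mem_of_mem_insert_of_ne hk hki)

theorem mem_tensorSubspace_iff {L : ∀ i, Submodule ℂ (Hilb (Fin (d i)))} {v : Hilb (Cfg d)} :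
    v ∈ tensorSubspace L ↔ ∀ i, act (ampliate (single d i) (proj (L i))) v = v := by
  refine ⟨fun h i => ?_, fun h => ?_⟩
  · suffices hle : tensorSubspace L ≤ fixedSpace (ampliate (single d i) (proj (L i))) from hle h
    refine Submodule.span_le.2 ?_
    rintro _ ⟨w, hw, rfl⟩
    rw [SetLike.mem_coe, mem_fixedSpace, act_ampliate_single_prodVec,
      act_proj_eq_self_iff.2 (hw i), Function.update_eq_self]
  · have hmem := mem_span_prodVec_of_act_eq_self (s := Finset.univ) fun i _ => h i
    simpa only [tensorSubspace, Finset.mem_univ, forall_const] using hmem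

end Multipartite

section Sites

variable {N : ℕ} {d : Fin N → ℕ} {S : Finset (Fin N)} {i : Fin N}

theorem slice_act_single_of_mem (hi : i ∈ S) (Y : Op (Fin (d i))) (v : Hilb (Cfg d))
    (b : Cfg fun j : {j // ¬ j ∈ S} => d j) :
    slice (split d S) (act (ampliate (single d i) Y) v) b =
      act (ampliate (single (fun j : {j // j ∈ S} => d j) ⟨i, hi⟩) Y) (slice (split d S) v b) := by
  have hupdate : ∀ (x : SubCfg d S) (a : Fin (d i)),
      Function.update ((split d S).symm (x, b)) i a =
        (split d S).symm (Function.update x ⟨i, hi⟩ a, b) := fun x a => by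
    funext j
    rcases eq_or_ne j i with rfl | hj
    · simp [hi]
    · by_cases hjS : j ∈ S <;> simp [hj, hjS, Function.update_of_ne]
  ext x
  simp only [slice_apply, act_ampliate_single, hupdate]
  simp [hi]

theorem slice_act_single_of_notMem (hi : i ∉ S) (Y : Op (Fin (d i))) (v : Hilb (Cfg d))
    (b : Cfg fun j : {j // ¬ j ∈ S} => d j) :
    slice (split d S) (act (ampliate (single d i) Y) v) b =
      ∑ a, Y (b ⟨i, hi⟩) a • slice (split d S) v (Function.update b ⟨i, hi⟩ a) := by
  have hupdate : ∀ (x : SubCfg d S) (a : Fin (d i)),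
      Function.update ((split d S).symm (x, b)) i a =
        (split d S).symm (x, Function.update b ⟨i, hi⟩ a) := fun x a => by
    funext j
    rcases eq_or_ne j i with rfl | hj
    · simp [hi]
    · by_cases hjS : j ∈ S <;> simp [hj, hjS, Function.update_of_ne]
  ext x
  simp [slice_apply, act_ampliate_single, hupdate, hi]

theorem ampliate_single_of_mem (hi : i ∈ S) (Y : Op (Fin (d i))) :
    ampliate (single d i) Y = ampliate (split d S)
      (ampliate (single (fun j : {j // j ∈ S} => d j) ⟨i, hi⟩) Y) :=
  op_ext fun v => slice_ext (split d S) fun b => by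
    rw [slice_act_single_of_mem hi, slice_act_ampliate]

theorem commute_ampliate_split_single (hi : i ∉ S) (X : Op (SubCfg d S)) (Y : Op (Fin (d i))) :
    Commute (ampliate (split d S) X) (ampliate (single d i) Y) :=
  op_ext fun v => slice_ext (split d S) fun b => by
    simp only [act_mul, slice_act_ampliate, slice_act_single_of_notMem hi, map_sum, map_smul]

theorem commute_ampliate_single {k : Fin N} (h : i ≠ k) (X : Op (Fin (d i)))
    (Y : Op (Fin (d k))) : Commute (ampliate (single d i) X) (ampliate (single d k) Y) := by
  rw [ampliate_single_of_mem (Finset.mem_singleton_self i)]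
  exact commute_ampliate_split_single (by simpa using h.symm) _ _

end Sites

/-! ### Local supports -/

section LocalSupport

theorem slice_mem_range_partialTrace {A B C : Type} [Fintype A] [Fintype B] [DecidableEq A]
    (e : C ≃ A × B) (ψ : Hilb C) (b : B) :
    slice e ψ b ∈ LinearMap.range (act (partialTrace e (ketbra ψ))) := by
  classical
  set T : Matrix A B ℂ := Matrix.of fun a b => ψ (e.symm (a, b))
  have hT : act (partialTrace e (ketbra ψ)) =
      T.toEuclideanLin ∘ₗ LinearMap.adjoint T.toEuclideanLin := by
    rw [← Matrix.toEuclideanLin_conjTranspose_eq_adjoint]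
    refine LinearMap.ext fun v => ?_
    rw [LinearMap.comp_apply, act, Matrix.toLpLin_apply, Matrix.toLpLin_apply,
      Matrix.toLpLin_apply, Matrix.mulVec_mulVec]
    rfl
  rw [hT, LinearMap.range_self_comp_adjoint]
  exact ⟨EuclideanSpace.single b 1, by ext a; simp [T, slice_apply]⟩

variable {N : ℕ} {d : Fin N → ℕ} {ψ : Hilb (Cfg d)} {S S' : Finset (Fin N)}

/-- The projector onto the site support at `i`, acting on the whole system. -/
def siteProj (d : Fin N → ℕ) (ψ : Hilb (Cfg d)) (i : Fin N) : Op (Cfg d) :=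
  ampliate (single d i) (proj (siteSupport d ψ i))

/-- The vectors that are locally supported at the sites in `S`, with no condition at the other
sites: the subspace `(⨂ i ∈ S, siteSupport i) ⊗ (⨂ i ∉ S, ℂ^(d i))`. -/
def partialSupport (d : Fin N → ℕ) (ψ : Hilb (Cfg d)) (S : Finset (Fin N)) :
    Submodule ℂ (Hilb (Cfg d)) :=
  ⨅ i ∈ S, fixedSpace (siteProj d ψ i)

theorem mem_partialSupport_iff {v : Hilb (Cfg d)} :
    v ∈ partialSupport d ψ S ↔ ∀ i ∈ S, act (siteProj d ψ i) v = v := by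
  simp only [partialSupport, Submodule.mem_iInf, mem_fixedSpace]

theorem partialSupport_univ : partialSupport d ψ Finset.univ = localSupport d ψ := by
  ext v
  simp only [mem_partialSupport_iff, Finset.mem_univ, forall_const]
  exact mem_tensorSubspace_iff.symm

theorem partialSupport_anti (h : S ⊆ S') : partialSupport d ψ S' ≤ partialSupport d ψ S :=
  biInf_mono fun _ hi => h hi

theorem localSupport_le_partialSupport (S : Finset (Fin N)) :
    localSupport d ψ ≤ partialSupport d ψ S :=
  partialSupport_univ.ge.trans (partialSupport_anti (Finset.subset_univ S))

theorem mem_partialSupport_iff_slice {v : Hilb (Cfg d)} :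
    v ∈ partialSupport d ψ S ↔ ∀ b, slice (split d S) v b ∈ localSupportOn d ψ S := by
  simp only [mem_partialSupport_iff, localSupportOn, mem_tensorSubspace_iff, Subtype.forall]
  refine ⟨fun h b i hi => ?_, fun h i hi => slice_ext (split d S) fun b => ?_⟩
  · rw [← slice_act_single_of_mem hi]
    exact congrArg (slice (split d S) · b) (h i hi)
  · rw [siteProj, slice_act_single_of_mem hi]
    exact h b i hi

theorem act_ampliate_mem_partialSupport (hSS' : S ⊆ S') {X : Op (SubCfg d S)}
    (hX : ∀ u ∈ localSupportOn d ψ S, act X u ∈ localSupportOn d ψ S) {v : Hilb (Cfg d)}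
    (hv : v ∈ partialSupport d ψ S') :
    act (ampliate (split d S) X) v ∈ partialSupport d ψ S' := by
  have hS : act (ampliate (split d S) X) v ∈ partialSupport d ψ S :=
    mem_partialSupport_iff_slice.2 fun b => by
      rw [slice_act_ampliate]
      exact hX _ (mem_partialSupport_iff_slice.1 (partialSupport_anti hSS' hv) b)
  refine mem_partialSupport_iff.2 fun i hi => ?_
  by_cases hiS : i ∈ S
  · exact mem_partialSupport_iff.1 hS i hiS
  · rw [siteProj, ← act_comm_of_commute (commute_ampliate_split_single hiS _ _)]
    exact congrArg _ (mem_partialSupport_iff.1 hv i hi)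

theorem act_ampliate_mem_localSupport {X : Op (SubCfg d S)}
    (hX : ∀ u ∈ localSupportOn d ψ S, act X u ∈ localSupportOn d ψ S) {v : Hilb (Cfg d)}
    (hv : v ∈ localSupport d ψ) : act (ampliate (split d S) X) v ∈ localSupport d ψ := by
  rw [← partialSupport_univ] at hv ⊢
  exact act_ampliate_mem_partialSupport (Finset.subset_univ S) hX hv

variable (d ψ) in
theorem self_mem_localSupport : ψ ∈ localSupport d ψ :=
  mem_tensorSubspace_iff.2 fun i => (act_ampliate_proj_eq_self_iff _).2 fun b =>
    slice_mem_range_partialTrace (single d i) ψ b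

theorem act_siteProj_self (i : Fin N) : act (siteProj d ψ i) ψ = ψ :=
  mem_tensorSubspace_iff.1 (self_mem_localSupport d ψ) i

variable (d ψ) in
theorem schmidtSpan_le_localSupportOn (S : Finset (Fin N)) :
    schmidtSpan (split d S) ψ ≤ localSupportOn d ψ S := by
  refine Submodule.span_le.2 ?_
  rintro _ ⟨b, rfl⟩
  exact mem_partialSupport_iff_slice.1
    (localSupport_le_partialSupport S (self_mem_localSupport d ψ)) b

theorem act_schmidtProj_mem_localSupport (S : Finset (Fin N)) {v : Hilb (Cfg d)}
    (hv : v ∈ localSupport d ψ) : act (schmidtProj d ψ S) v ∈ localSupport d ψ :=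
  act_ampliate_mem_localSupport
    (fun _ _ => schmidtSpan_le_localSupportOn d ψ S (act_proj_mem _ _)) hv

theorem act_schmidtProj_self (S : Finset (Fin N)) : act (schmidtProj d ψ S) ψ = ψ :=
  (act_ampliate_proj_eq_self_iff _).2 fun b => Submodule.subset_span ⟨b, rfl⟩

theorem conjTranspose_schmidtProj (S : Finset (Fin N)) :
    (schmidtProj d ψ S)ᴴ = schmidtProj d ψ S := by
  rw [schmidtProj, ← ampliate_conjTranspose, conjTranspose_proj]

theorem schmidtProj_mul_self (S : Finset (Fin N)) :
    schmidtProj d ψ S * schmidtProj d ψ S = schmidtProj d ψ S := by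
  rw [schmidtProj, ← ampliate_mul, proj_mul_self]

theorem exists_norm_eq_one_mem_siteSupport (hψ : ψ ≠ 0) (i : Fin N) :
    ∃ τ ∈ siteSupport d ψ i, ‖τ‖ = 1 := by
  obtain ⟨b, hb⟩ : ∃ b, slice (single d i) ψ b ≠ 0 := by
    by_contra! h
    exact hψ (slice_ext (single d i) h)
  exact ⟨_, Submodule.smul_mem _ ((‖slice (single d i) ψ b‖⁻¹ : ℝ) : ℂ)
    (slice_mem_range_partialTrace (single d i) ψ b), by simp [norm_smul, hb]⟩

theorem act_eq_zero_of_partialSupport_insert (hψ : ψ ≠ 0) {i : Fin N} {T : Op (Cfg d)}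
    (hT : ∀ Y, Commute T (ampliate (single d i) Y))
    (h : ∀ v ∈ partialSupport d ψ (insert i S), act T v = 0) {v : Hilb (Cfg d)}
    (hv : v ∈ partialSupport d ψ S) : act T v = 0 := by
  obtain ⟨τ, hτ, hτ1⟩ := exists_norm_eq_one_mem_siteSupport hψ i
  have hτ0 : τ ≠ 0 := norm_ne_zero_iff.1 (hτ1 ▸ one_ne_zero)
  refine eq_zero_of_act_ampliate_ketBasis (single d i) hτ0 fun c => ?_
  rw [← act_comm_of_commute (hT _)]
  refine h _ (mem_partialSupport_iff.2 fun k hk => ?_)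
  rcases eq_or_ne k i with rfl | hki
  · refine (act_ampliate_proj_eq_self_iff _).2 fun b => ?_
    rw [slice_act_ampliate, act_ketBasis]
    exact Submodule.smul_mem _ _ hτ
  · rw [siteProj, act_comm_of_commute (commute_ampliate_single hki _ _)]
    exact congrArg _ (mem_partialSupport_iff.1 hv k (Finset.mem_of_mem_insert_of_ne hk hki))

/-- Writing any vector of `siteSupport i` into the sites outside `S` moves a vector of
`partialSupport S` into the local support, and `T` does not notice. -/
theorem act_eq_zero_of_localSupport (hψ : ψ ≠ 0) {T : Op (Cfg d)}
    (hT : ∀ i ∉ S, ∀ Y, Commute T (ampliate (single d i) Y))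
    (h : ∀ v ∈ localSupport d ψ, act T v = 0) : ∀ v ∈ partialSupport d ψ S, act T v = 0 := by
  suffices hU : ∀ U : Finset (Fin N), (∀ v ∈ partialSupport d ψ (S ∪ U), act T v = 0) →
      ∀ v ∈ partialSupport d ψ S, act T v = 0 from
    hU Finset.univ (by rwa [Finset.union_eq_right.2 (Finset.subset_univ S), partialSupport_univ])
  intro U
  induction U using Finset.induction with
  | empty => rw [Finset.union_empty]; exact id
  | insert i U _ ih =>
    intro hiU
    refine ih fun v hv => ?_
    by_cases hi : i ∈ S ∪ U
    · exact hiU v (by rwa [Finset.union_insert, Finset.insert_eq_of_mem hi])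
    · exact act_eq_zero_of_partialSupport_insert hψ
        (hT i fun hiS => hi (Finset.mem_union_left U hiS)) (by rwa [← Finset.union_insert]) hv

end LocalSupport

/-! ### Neighborhood algebras -/

section ConjTranspose

variable {n : Type} [Fintype n] [DecidableEq n] {L : Submodule ℂ (Hilb n)} {X : Op n}

-- Instance search does not identify the two additive structures that a subspace of `Hilb n` gets
-- from its submodule and from its normed-space structure, so the arguments are given by position.
instance : StarRing (Module.End ℂ L) := @LinearMap.instStarRingId ℂ L _ _ _ _

instance : StarModule ℂ (Module.End ℂ L) := @LinearMap.instStarModuleId ℂ L _ _ _ _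

theorem act_conjTranspose_mem {c : ℂ} (hc : ∀ v ∈ Lᗮ, act X v = c • v) {v : Hilb n}
    (hv : v ∈ L) : act Xᴴ v ∈ L := by
  rw [← Submodule.orthogonal_orthogonal L, Submodule.mem_orthogonal]
  intro w hw
  rw [← inner_act_left, hc w hw, inner_smul_left, Submodule.inner_left_of_mem_orthogonal hv hw,
    mul_zero]

theorem act_conjTranspose_eq_smul_of_mem_orthogonal (hX : ∀ v ∈ L, act X v ∈ L) {c : ℂ}
    (hc : ∀ v ∈ Lᗮ, act X v = c • v) {w : Hilb n} (hw : w ∈ Lᗮ) : act Xᴴ w = star c • w := by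
  refine ext_inner_right ℂ fun u => ?_
  obtain ⟨u₁, h₁, u₂, h₂, rfl⟩ := L.exists_add_mem_mem_orthogonal u
  rw [← inner_act_right, map_add, hc u₂ h₂, inner_add_right, inner_smul_left, inner_add_right,
    Submodule.inner_left_of_mem_orthogonal (hX _ h₁) hw,
    Submodule.inner_left_of_mem_orthogonal h₁ hw, inner_smul_right, zero_add, zero_add,
    RCLike.star_def, RCLike.conj_conj]

theorem star_restrict_act (hX : ∀ v ∈ L, act X v ∈ L) (hX' : ∀ v ∈ L, act Xᴴ v ∈ L) :
    star ((act X).restrict hX) = (act Xᴴ).restrict hX' :=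
  ((LinearMap.eq_adjoint_iff _ _).2 fun v w => (inner_act_right X v.1 w.1).symm).symm

end ConjTranspose

section NeighborhoodAlgebra

variable {N K : ℕ} {d : Fin N → ℕ} {nbhd : Fin K → Finset (Fin N)} {ψ : Hilb (Cfg d)}

variable (d ψ) in
/-- The restriction of a Schmidt-span projector to the local support. -/
def localSchmidtProj (S : Finset (Fin N)) : Module.End ℂ (localSupport d ψ) :=
  (act (schmidtProj d ψ S)).restrict fun _ hv => act_schmidtProj_mem_localSupport S hv

theorem coe_localSchmidtProj (S : Finset (Fin N)) (v : localSupport d ψ) :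
    (localSchmidtProj d ψ S v : Hilb (Cfg d)) = act (schmidtProj d ψ S) (v : Hilb (Cfg d)) := rfl

theorem isStarProjection_localSchmidtProj (S : Finset (Fin N)) :
    IsStarProjection (localSchmidtProj d ψ S) where
  isIdempotentElem := LinearMap.ext fun v => Subtype.ext <| by
    rw [Module.End.mul_apply, coe_localSchmidtProj, coe_localSchmidtProj, ← act_mul,
      schmidtProj_mul_self]
  isSelfAdjoint := by
    rw [IsSelfAdjoint, localSchmidtProj, star_restrict_act _ fun v hv => by
      rw [conjTranspose_schmidtProj]; exact act_schmidtProj_mem_localSupport S hv]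
    simp only [conjTranspose_schmidtProj]

theorem act_mem_localSupport {j : Fin K} {A : Op (Cfg d)}
    (hA : A ∈ neighborhoodAlgebra d nbhd ψ j) {v : Hilb (Cfg d)} (hv : v ∈ localSupport d ψ) :
    act A v ∈ localSupport d ψ := by
  obtain ⟨X, rfl, hX, -⟩ := hA
  exact act_ampliate_mem_localSupport hX hv

theorem smul_one_mem_neighborhoodAlgebra (j : Fin K) (c : ℂ) :
    c • (1 : Op (Cfg d)) ∈ neighborhoodAlgebra d nbhd ψ j := by
  refine ⟨c • 1, by rw [ampliate_smul, ampliate_one], fun v hv => ?_, ⟨c, fun v _ => ?_⟩,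
    fun k _ v _ => ?_⟩
  · rw [act_smul, act_one]
    exact Submodule.smul_mem _ _ hv
  · rw [act_smul, act_one]
  · rw [act_smul, act_smul, act_one, act_one, map_smul]

theorem mul_mem_neighborhoodAlgebra {j : Fin K} {A B : Op (Cfg d)}
    (hA : A ∈ neighborhoodAlgebra d nbhd ψ j) (hB : B ∈ neighborhoodAlgebra d nbhd ψ j) :
    A * B ∈ neighborhoodAlgebra d nbhd ψ j := by
  have hB' := fun v hv => act_mem_localSupport (v := v) hB hv
  obtain ⟨X, rfl, hX, ⟨c, hc⟩, hXk⟩ := hA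
  obtain ⟨Y, rfl, hY, ⟨c', hc'⟩, hYk⟩ := hB
  refine ⟨X * Y, (ampliate_mul _ _ _).symm, fun v hv => ?_, ⟨c' * c, fun v hv => ?_⟩,
    fun k hk v hv => ?_⟩
  · rw [act_mul]
    exact hX _ (hY _ hv)
  · rw [act_mul, hc' v hv, map_smul, hc v hv, smul_smul]
  · rw [act_mul, act_mul, hYk k hk v hv, hXk k hk _ (hB' v hv)]

theorem add_mem_neighborhoodAlgebra {j : Fin K} {A B : Op (Cfg d)}
    (hA : A ∈ neighborhoodAlgebra d nbhd ψ j) (hB : B ∈ neighborhoodAlgebra d nbhd ψ j) :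
    A + B ∈ neighborhoodAlgebra d nbhd ψ j := by
  obtain ⟨X, rfl, hX, ⟨c, hc⟩, hXk⟩ := hA
  obtain ⟨Y, rfl, hY, ⟨c', hc'⟩, hYk⟩ := hB
  refine ⟨X + Y, (ampliate_add _ _ _).symm, fun v hv => ?_, ⟨c + c', fun v hv => ?_⟩,
    fun k hk v hv => ?_⟩
  · rw [act_add]
    exact Submodule.add_mem _ (hX _ hv) (hY _ hv)
  · rw [act_add, hc v hv, hc' v hv, add_smul]
  · rw [act_add, act_add, hXk k hk v hv, hYk k hk v hv, map_add]

theorem commute_localSchmidtProj {j k : Fin K} (hk : k ≠ j)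
    {Y : Module.End ℂ (localSupport d ψ)} (hY : Y ∈ restrictedAlgebra d nbhd ψ j) :
    Commute Y (localSchmidtProj d ψ (nbhd k)) := by
  obtain ⟨A, ⟨X, -, -, -, hcomm⟩, hY⟩ := hY
  refine LinearMap.ext fun v => Subtype.ext ?_
  rw [Module.End.mul_apply, Module.End.mul_apply, hY, coe_localSchmidtProj, coe_localSchmidtProj,
    hY, hcomm k hk v v.2]

theorem conjTranspose_mem_neighborhoodAlgebra {j : Fin K} {A : Op (Cfg d)}
    (hA : A ∈ neighborhoodAlgebra d nbhd ψ j) : Aᴴ ∈ neighborhoodAlgebra d nbhd ψ j := by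
  have hAL := fun v hv => act_mem_localSupport (v := v) hA hv
  have hA' := hA
  obtain ⟨X, hAX, hX, ⟨c, hc⟩, -⟩ := hA'
  have hAX' : Aᴴ = ampliate (split d (nbhd j)) Xᴴ := by rw [hAX, ampliate_conjTranspose]
  have hAL' : ∀ v ∈ localSupport d ψ, act Aᴴ v ∈ localSupport d ψ := fun v hv => by
    rw [hAX']
    exact act_ampliate_mem_localSupport (fun _ => act_conjTranspose_mem hc) hv
  refine ⟨Xᴴ, hAX', fun _ => act_conjTranspose_mem hc,
    ⟨_, fun _ => act_conjTranspose_eq_smul_of_mem_orthogonal hX hc⟩, fun k hk v hv => ?_⟩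
  have hcomm := (commute_localSchmidtProj hk
    (Y := (act A).restrict hAL) ⟨A, hA, fun _ => rfl⟩).star_star
  rw [star_restrict_act hAL hAL',
    (isStarProjection_localSchmidtProj (nbhd k)).isSelfAdjoint.star_eq] at hcomm
  exact congrArg Subtype.val (LinearMap.congr_fun hcomm.eq ⟨v, hv⟩)

variable (d nbhd ψ) in
/-- The restriction of the neighborhood algebra to the local support, as a star subalgebra. -/
def restrictedStarSubalgebra (j : Fin K) :
    StarSubalgebra ℂ (Module.End ℂ (localSupport d ψ)) where
  carrier := restrictedAlgebra d nbhd ψ j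
  mul_mem' := by
    rintro Y Z ⟨A, hA, hY⟩ ⟨B, hB, hZ⟩
    exact ⟨A * B, mul_mem_neighborhoodAlgebra hA hB, fun v => by
      rw [Module.End.mul_apply, hY, hZ, act_mul]⟩
  add_mem' := by
    rintro Y Z ⟨A, hA, hY⟩ ⟨B, hB, hZ⟩
    exact ⟨A + B, add_mem_neighborhoodAlgebra hA hB, fun v => by
      rw [LinearMap.add_apply, Submodule.coe_add, hY, hZ, act_add]⟩
  algebraMap_mem' c := ⟨c • 1, smul_one_mem_neighborhoodAlgebra j c, fun v => by
    rw [act_smul, act_one, Module.algebraMap_end_apply, Submodule.coe_smul]⟩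
  star_mem' := by
    rintro Y ⟨A, hA, hY⟩
    have hA' := conjTranspose_mem_neighborhoodAlgebra hA
    obtain rfl : Y = (act A).restrict fun _ hv => act_mem_localSupport hA hv :=
      LinearMap.ext fun v => Subtype.ext (hY v)
    rw [star_restrict_act _ fun _ hv => act_mem_localSupport hA' hv]
    exact ⟨_, hA', fun _ => rfl⟩

end NeighborhoodAlgebra

/-! ### Commuting star subalgebras of a full operator algebra -/

section Centralizer

open LinearMap (trace)
open scoped TensorProduct

variable {V : Type} [NormedAddCommGroup V] [InnerProductSpace ℂ V] [FiniteDimensional ℂ V]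
  {A B : StarSubalgebra ℂ (Module.End ℂ V)}

theorem eq_zero_of_trace_star_mul_self {Y : Module.End ℂ V} (h : trace ℂ V (star Y * Y) = 0) :
    Y = 0 := by
  let b := stdOrthonormalBasis ℂ V
  have hsum : ((∑ i, ‖Y (b i)‖ ^ 2 : ℝ) : ℂ) = 0 := by
    rw [← h, LinearMap.trace_eq_sum_inner _ b, Complex.ofReal_sum]
    refine Finset.sum_congr rfl fun i _ => ?_
    rw [Module.End.mul_apply, LinearMap.star_eq_adjoint, LinearMap.adjoint_inner_right,
      inner_self_eq_norm_sq_to_K, Complex.ofReal_pow]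
    rfl
  rw [Complex.ofReal_eq_zero, Finset.sum_eq_zero_iff_of_nonneg fun i _ => sq_nonneg _] at hsum
  refine b.toBasis.ext fun i => ?_
  rw [OrthonormalBasis.coe_toBasis, LinearMap.zero_apply]
  exact norm_eq_zero.1 (pow_eq_zero_iff two_ne_zero |>.1 (hsum i (Finset.mem_univ i)))

theorem eq_zero_of_forall_trace_mul_eq_zero {Y : Module.End ℂ V} (hY : Y ∈ B)
    (h : ∀ b ∈ B, trace ℂ V (b * Y) = 0) : Y = 0 :=
  eq_zero_of_trace_star_mul_self (h _ (star_mem hY))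

theorem exists_mem_forall_trace_mul_eq (B : StarSubalgebra ℂ (Module.End ℂ V))
    (X : Module.End ℂ V) : ∃ Z ∈ B, ∀ b ∈ B, trace ℂ V (b * Z) = trace ℂ V (b * X) := by
  let form : LinearMap.BilinForm ℂ (Module.End ℂ V) :=
    (LinearMap.mul ℂ (Module.End ℂ V)).compr₂ (trace ℂ V)
  let S := Subalgebra.toSubmodule B.toSubalgebra
  have hrefl : form.IsRefl := fun Y Z h => (LinearMap.trace_mul_comm ℂ Z Y).trans h
  have hcompl : IsCompl S (form.orthogonal S) :=
    (LinearMap.BilinForm.isCompl_orthogonal_iff_disjoint hrefl).2 <|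
      Submodule.disjoint_def.2 fun _ => eq_zero_of_forall_trace_mul_eq_zero
  obtain ⟨Z, hZ, Y, hY, rfl⟩ := Submodule.mem_sup.1 (hcompl.sup_eq_top ▸ Submodule.mem_top (x := X))
  exact ⟨Z, hZ, fun b hb => by rw [mul_add, map_add, show trace ℂ V (b * Y) = 0 from hY b hb,
    add_zero]⟩

theorem mem_center_of_commute (hgen : A.toSubalgebra ⊔ B.toSubalgebra = ⊤) {Z : Module.End ℂ V}
    (hA : ∀ a ∈ A, Commute a Z) (hB : ∀ b ∈ B, Commute b Z) :
    Z ∈ Subalgebra.center ℂ (Module.End ℂ V) := by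
  have hle : A.toSubalgebra ⊔ B.toSubalgebra ≤ Subalgebra.centralizer ℂ {Z} :=
    sup_le (fun a ha => by rintro _ rfl; exact (hA a ha).symm)
      (fun b hb => by rintro _ rfl; exact (hB b hb).symm)
  rw [hgen, top_le_iff] at hle
  exact Subalgebra.mem_center_iff.2 fun T => ((hle ▸ Algebra.mem_top : T ∈ _) Z rfl).symm

theorem exists_forall_trace_mul_eq_mul_trace (hgen : A.toSubalgebra ⊔ B.toSubalgebra = ⊤)
    (hcomm : ∀ a ∈ A, ∀ b ∈ B, Commute a b) {X : Module.End ℂ V} (hX : ∀ b ∈ B, Commute b X) :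
    ∃ c : ℂ, ∀ b ∈ B, trace ℂ V (b * X) = c * trace ℂ V b := by
  obtain ⟨Z, hZ, hZX⟩ := exists_mem_forall_trace_mul_eq B X
  have hBZ : ∀ b ∈ B, Commute b Z := fun b hb => by
    refine sub_eq_zero.1 <| eq_zero_of_forall_trace_mul_eq_zero
      (sub_mem (mul_mem hb hZ) (mul_mem hZ hb)) fun a ha => ?_
    rw [mul_sub, map_sub, sub_eq_zero]
    calc trace ℂ V (a * (b * Z))
        = trace ℂ V (a * b * X) := by rw [← mul_assoc, hZX _ (mul_mem ha hb)]
      _ = trace ℂ V (b * a * X) := by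
          rw [mul_assoc, (hX b hb).eq, ← mul_assoc, LinearMap.trace_mul_comm, ← mul_assoc]
      _ = trace ℂ V (a * (Z * b)) := by
          rw [← hZX _ (mul_mem hb ha), mul_assoc, LinearMap.trace_mul_comm, mul_assoc]
  obtain ⟨c, rfl⟩ := (Algebra.IsCentral.mem_center_iff ℂ).1 <|
    mem_center_of_commute hgen (fun a ha => hcomm a ha Z hZ) hBZ
  refine ⟨c, fun b hb => ?_⟩
  rw [← hZX b hb, Algebra.algebraMap_eq_smul_one, mul_smul_comm, mul_one, map_smul, smul_eq_mul]

theorem eq_zero_of_commute_of_trace (hgen : A.toSubalgebra ⊔ B.toSubalgebra = ⊤)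
    (hcomm : ∀ a ∈ A, ∀ b ∈ B, Commute a b) {D : Module.End ℂ V} (hD : ∀ b ∈ B, Commute b D)
    (hA : ∀ a ∈ A, trace ℂ V (a * D) = 0) : D = 0 := by
  rcases subsingleton_or_nontrivial V with _ | _
  · exact Subsingleton.elim _ _
  have hAB : ∀ a ∈ A, ∀ b ∈ B, trace ℂ V (b * a * D) = 0 := fun a ha b hb => by
    obtain ⟨c, hc⟩ := exists_forall_trace_mul_eq_mul_trace hgen hcomm (X := a * D)
      fun b hb => (hcomm a ha b hb).symm.mul_right (hD b hb)
    have hc0 : c = 0 := by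
      simpa [LinearMap.trace_one, hA a ha, Module.finrank_pos.ne'] using hc 1 (one_mem B)
    rw [mul_assoc, hc b hb, hc0, zero_mul]
  let f := Algebra.TensorProduct.lift B.toSubalgebra.val A.toSubalgebra.val
    fun b a => (hcomm a a.2 b b.2).symm
  have hf : f.range = ⊤ := by
    rw [← top_le_iff, ← hgen]
    refine sup_le (fun a ha => ⟨1 ⊗ₜ ⟨a, ha⟩, ?_⟩) fun b hb => ⟨⟨b, hb⟩ ⊗ₜ 1, ?_⟩
    · exact (Algebra.TensorProduct.lift_tmul ..).trans (by rw [map_one, one_mul]; rfl)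
    · exact (Algebra.TensorProduct.lift_tmul ..).trans (by rw [map_one, mul_one]; rfl)
  have hfD : ∀ t, trace ℂ V (f t * D) = 0 := fun t => by
    induction t with
    | zero => rw [map_zero, zero_mul, map_zero]
    | add s t hs ht => rw [map_add, add_mul, map_add, hs, ht, add_zero]
    | tmul b a => exact hAB a a.2 b b.2
  obtain ⟨t, ht⟩ := (hf ▸ Algebra.mem_top : star D ∈ f.range)
  exact eq_zero_of_trace_star_mul_self (ht ▸ hfD t)

theorem mem_of_forall_commute (hgen : A.toSubalgebra ⊔ B.toSubalgebra = ⊤)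
    (hcomm : ∀ a ∈ A, ∀ b ∈ B, Commute a b) {C : Module.End ℂ V} (hC : ∀ b ∈ B, Commute b C) :
    C ∈ A := by
  obtain ⟨Z, hZ, hZC⟩ := exists_mem_forall_trace_mul_eq A C
  have hsub : C - Z = 0 := eq_zero_of_commute_of_trace hgen hcomm
    (fun b hb => (hC b hb).sub_right (hcomm Z hZ b hb).symm)
    fun a ha => by rw [mul_sub, map_sub, hZC a ha, sub_self]
  rwa [sub_eq_zero.1 hsub]

theorem mem_of_forall_ne_commute {κ : Type} {𝒜 : κ → StarSubalgebra ℂ (Module.End ℂ V)}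
    (hcomm : IsCommutingFamily fun j => (𝒜 j : Set (Module.End ℂ V)))
    (hcompl : IsCompleteFamily fun j => (𝒜 j : Set (Module.End ℂ V))) {j : κ}
    {C : Module.End ℂ V} (hC : ∀ k ≠ j, ∀ Y ∈ 𝒜 k, Commute Y C) : C ∈ 𝒜 j := by
  let B := StarSubalgebra.centralizer ℂ ((𝒜 j : Set (Module.End ℂ V)) ∪ {C})
  have hB : ∀ k ≠ j, 𝒜 k ≤ B := fun k hk Y hY => by
    rw [StarSubalgebra.mem_centralizer_iff]
    rintro Z (hZ | rfl)
    · exact ⟨hcomm j k hk.symm Z hZ Y hY, hcomm j k hk.symm _ (star_mem hZ) Y hY⟩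
    · exact ⟨(hC k hk Y hY).eq.symm, (commute_star_comm.1 (hC k hk _ (star_mem hY))).eq.symm⟩
  have hgen : (𝒜 j).toSubalgebra ⊔ B.toSubalgebra = ⊤ := by
    rw [← top_le_iff, ← hcompl]
    refine Algebra.adjoin_le (Set.iUnion_subset fun k Y hY => ?_)
    rcases eq_or_ne k j with rfl | hk
    · exact (le_sup_left : (𝒜 k).toSubalgebra ≤ _) hY
    · exact (le_sup_right : B.toSubalgebra ≤ _) (hB k hk hY)
  have hBcomm := fun b (hb : b ∈ B) => (StarSubalgebra.mem_centralizer_iff ℂ).1 hb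
  exact mem_of_forall_commute hgen (fun a ha b hb => (hBcomm b hb a (Or.inl ha)).1)
    fun b hb => (hBcomm b hb C (Or.inr rfl)).1.symm

end Centralizer

/-! ### Tensor factorizations from commuting algebras -/

section Factorization

variable {κ V : Type} [NormedAddCommGroup V] [InnerProductSpace ℂ V] [FiniteDimensional ℂ V]

/-- The algebras `𝒜 j` commute and contain projections `P j` whose only joint fixed vectors are
the multiples of the unit vector `ψ`: the `P j` are the ground state projections of a commuting
frustration-free Hamiltonian with the unique ground state `ψ`. -/
structure IsUniqueGroundState (𝒜 : κ → StarSubalgebra ℂ (Module.End ℂ V))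
    (P : κ → Module.End ℂ V) (ψ : V) : Prop where
  isCommutingFamily : IsCommutingFamily fun j => (𝒜 j : Set (Module.End ℂ V))
  proj_mem : ∀ j, P j ∈ 𝒜 j
  isStarProjection : ∀ j, IsStarProjection (P j)
  norm_eq_one : ‖ψ‖ = 1
  proj_apply : ∀ j, P j ψ = ψ
  exists_eq_smul : ∀ v, (∀ j, P j v = v) → ∃ c : ℂ, v = c • ψ

namespace IsUniqueGroundState

variable {𝒜 : κ → StarSubalgebra ℂ (Module.End ℂ V)} {P : κ → Module.End ℂ V} {ψ : V}

theorem proj_apply_apply (h : IsUniqueGroundState 𝒜 P ψ) {j : κ} {Y : Module.End ℂ V}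
    (hY : Y ∈ 𝒜 j) : P j (Y ψ) = inner ℂ ψ (Y ψ) • ψ := by
  obtain ⟨c, hc⟩ := h.exists_eq_smul (P j (Y ψ)) fun k => by
    rcases eq_or_ne k j with rfl | hk
    · rw [← Module.End.mul_apply, (h.isStarProjection k).isIdempotentElem.eq]
    · rw [← Module.End.mul_apply (P j), ← Module.End.mul_apply,
        h.isCommutingFamily k j hk _ (h.proj_mem k) _ (mul_mem (h.proj_mem j) hY),
        Module.End.mul_apply, h.proj_apply, Module.End.mul_apply]
  have hψψ : inner ℂ ψ ψ = (1 : ℂ) := by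
    rw [inner_self_eq_norm_sq_to_K, h.norm_eq_one, RCLike.ofReal_one, one_pow]
  have hPj : inner ℂ ψ (P j (Y ψ)) = (inner ℂ ψ (Y ψ) : ℂ) := by
    rw [← LinearMap.adjoint_inner_left, ← LinearMap.star_eq_adjoint,
      (h.isStarProjection j).isSelfAdjoint.star_eq, h.proj_apply]
  rw [hc, inner_smul_right, hψψ, mul_one] at hPj
  rw [hc, hPj]

theorem inner_mul_apply (h : IsUniqueGroundState 𝒜 P ψ) {j : κ} {X Y S T : Module.End ℂ V}
    (hX : X ∈ 𝒜 j) (hY : Y ∈ 𝒜 j) (hS : ∀ Z ∈ 𝒜 j, Commute Z S) (hT : ∀ Z ∈ 𝒜 j, Commute Z T) :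
    inner ℂ ((X * S) ψ) ((Y * T) ψ) = (inner ℂ (X ψ) (Y ψ) * inner ℂ (S ψ) (T ψ) : ℂ) := by
  have hXY : star X * Y ∈ 𝒜 j := mul_mem (star_mem hX) hY
  have hP := h.proj_mem j
  calc inner ℂ ((X * S) ψ) ((Y * T) ψ)
      = inner ℂ ((S * P j) ψ) ((star X * Y * T) ψ) := by
        rw [mul_assoc, Module.End.mul_apply (star X), LinearMap.star_eq_adjoint,
          LinearMap.adjoint_inner_right, Module.End.mul_apply, Module.End.mul_apply S,
          h.proj_apply]
    _ = inner ℂ (S ψ) (T (P j ((star X * Y) ψ))) := by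
        rw [← (hS _ hP).eq, (hT _ hXY).eq, Module.End.mul_apply,
          ← LinearMap.adjoint_inner_right, ← LinearMap.star_eq_adjoint,
          (h.isStarProjection j).isSelfAdjoint.star_eq, ← Module.End.mul_apply, ← mul_assoc,
          (hT _ hP).eq]
        rfl
    _ = inner ℂ (X ψ) (Y ψ) * inner ℂ (S ψ) (T ψ) := by
        rw [h.proj_apply_apply hXY, map_smul, inner_smul_right, Module.End.mul_apply,
          LinearMap.star_eq_adjoint, LinearMap.adjoint_inner_right]

variable [Fintype κ]

/-- The multiplication homomorphism `a ↦ ∏ j, a j` of the commuting algebras `𝒜 j`. -/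
def mulHom (h : IsUniqueGroundState 𝒜 P ψ) : (∀ j, 𝒜 j) →* Module.End ℂ V :=
  MonoidHom.noncommPiCoprod (fun j => ((𝒜 j).toSubalgebra.val : 𝒜 j →* Module.End ℂ V))
    fun j k hjk X Y => h.isCommutingFamily j k hjk X X.2 Y Y.2

theorem inner_mulHom_apply (h : IsUniqueGroundState 𝒜 P ψ) (a b : ∀ j, 𝒜 j) :
    inner ℂ (h.mulHom a ψ) (h.mulHom b ψ) =
      (∏ j, inner ℂ ((a j : Module.End ℂ V) ψ) ((b j : Module.End ℂ V) ψ) : ℂ) := by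
  classical
  have comm (a : ∀ j, 𝒜 j) (s : Finset κ) :
      (s : Set κ).Pairwise (Function.onFun Commute fun j => (a j : Module.End ℂ V)) :=
    fun j _ k _ hjk => h.isCommutingFamily j k hjk _ (a j).2 _ (a k).2
  have hprod (s : Finset κ) : inner ℂ (s.noncommProd (fun j => (a j : Module.End ℂ V)) (comm a s) ψ)
      (s.noncommProd (fun j => (b j : Module.End ℂ V)) (comm b s) ψ) =
      (∏ j ∈ s, inner ℂ ((a j : Module.End ℂ V) ψ) ((b j : Module.End ℂ V) ψ) : ℂ) := by
    induction s using Finset.induction_on with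
    | empty =>
      rw [Finset.noncommProd_empty, Finset.noncommProd_empty, Finset.prod_empty,
        Module.End.one_apply, inner_self_eq_norm_sq_to_K, h.norm_eq_one, RCLike.ofReal_one,
        one_pow]
    | insert i s hi ih =>
      have hcomm (a : ∀ j, 𝒜 j) (Z) (hZ : Z ∈ 𝒜 i) :
          Commute Z (s.noncommProd (fun j => (a j : Module.End ℂ V)) (comm a s)) :=
        Finset.noncommProd_commute _ _ _ _ fun k hk =>
          h.isCommutingFamily i k (ne_of_mem_of_not_mem hk hi).symm Z hZ _ (a k).2
      rw [Finset.noncommProd_insert_of_notMem _ _ _ _ hi,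
        Finset.noncommProd_insert_of_notMem _ _ _ _ hi,
        h.inner_mul_apply (a i).2 (b i).2 (hcomm a) (hcomm b), ih, Finset.prod_insert hi]
  exact hprod Finset.univ

variable [DecidableEq κ]

theorem mulHom_update (h : IsUniqueGroundState 𝒜 P ψ) (a : ∀ j, 𝒜 j) (j : κ) (X : 𝒜 j) :
    h.mulHom (Function.update a j X) = h.mulHom (Function.update a j 1) * X := by
  rw [← show h.mulHom (Pi.mulSingle j X) = X from MonoidHom.noncommPiCoprod_mulSingle
    (N := fun j => 𝒜 j) (fun j => ((𝒜 j).toSubalgebra.val : 𝒜 j →* Module.End ℂ V)) j X,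
    ← map_mul]
  congr 1
  funext k
  rcases eq_or_ne k j with rfl | hk <;> simp [*]

theorem mul_mulHom (h : IsUniqueGroundState 𝒜 P ψ) (a : ∀ j, 𝒜 j) (j : κ) (X : 𝒜 j) :
    X * h.mulHom a = h.mulHom (Function.update a j (X * a j)) := by
  rw [← show h.mulHom (Pi.mulSingle j X) = X from MonoidHom.noncommPiCoprod_mulSingle
    (N := fun j => 𝒜 j) (fun j => ((𝒜 j).toSubalgebra.val : 𝒜 j →* Module.End ℂ V)) j X,
    ← map_mul]
  congr 1
  funext k
  rcases eq_or_ne k j with rfl | hk <;> simp [*]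

end IsUniqueGroundState

/-- The operators `A x` of the algebra `B` send `ψ` to an orthonormal basis of the subspace
`B ψ`. -/
structure IsOrbitBasis (B : StarSubalgebra ℂ (Module.End ℂ V)) (ψ : V) {m : ℕ}
    (A : Fin m → B) : Prop where
  orthonormal : Orthonormal ℂ fun x => (A x : Module.End ℂ V) ψ
  eq_sum : ∀ X ∈ B, X ψ = ∑ x, inner ℂ ((A x : Module.End ℂ V) ψ) (X ψ) • (A x : Module.End ℂ V) ψ

theorem exists_isOrbitBasis (B : StarSubalgebra ℂ (Module.End ℂ V)) (ψ : V) :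
    ∃ (m : ℕ) (A : Fin m → B), IsOrbitBasis B ψ A := by
  let M : Submodule ℂ V := (Subalgebra.toSubmodule B.toSubalgebra).map (LinearMap.applyₗ ψ)
  let u := stdOrthonormalBasis ℂ M
  have hu (x) : ∃ X : B, (X : Module.End ℂ V) ψ = u x := by
    obtain ⟨X, hX, h⟩ := (u x).2
    exact ⟨⟨X, hX⟩, h⟩
  choose A hA using hu
  refine ⟨_, A, ⟨?_, fun X hX => ?_⟩⟩
  · simpa only [hA] using! u.orthonormal.comp_linearIsometry M.subtypeₗᵢ
  · have hsum := congrArg Subtype.val (u.sum_repr' ⟨X ψ, X, hX, rfl⟩)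
    simpa only [AddSubmonoidClass.coe_finsetSum, Submodule.coe_smul, Submodule.coe_inner, ← hA]
      using hsum.symm

section ProductBasis

variable [Fintype κ] {𝒜 : κ → StarSubalgebra ℂ (Module.End ℂ V)}
  {P : κ → Module.End ℂ V} {ψ : V} {m : κ → ℕ} {A : ∀ j, Fin (m j) → 𝒜 j}

namespace IsUniqueGroundState

theorem orthonormal_mulHom (h : IsUniqueGroundState 𝒜 P ψ)
    (hA : ∀ j, IsOrbitBasis (𝒜 j) ψ (A j)) :
    Orthonormal ℂ fun x : Cfg m => h.mulHom (fun j => A j (x j)) ψ := by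
  rw [orthonormal_iff_ite]
  intro x y
  simp only [h.inner_mulHom_apply, orthonormal_iff_ite.1 (hA _).orthonormal,
    Finset.prod_ite_zero, funext_iff, Finset.mem_univ, true_imp_iff, Finset.prod_const_one]

theorem apply_mulHom [DecidableEq κ] (h : IsUniqueGroundState 𝒜 P ψ)
    (hA : ∀ j, IsOrbitBasis (𝒜 j) ψ (A j))
    {j : κ} {Y : Module.End ℂ V} (hY : Y ∈ 𝒜 j) (x : Cfg m) :
    Y (h.mulHom (fun k => A k (x k)) ψ) =
      ∑ y, inner ℂ ((A j y : Module.End ℂ V) ψ) (Y ((A j (x j) : Module.End ℂ V) ψ)) •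
        h.mulHom (fun k => A k (Function.update x j y k)) ψ := by
  have hupd (y) : (fun k => A k (Function.update x j y k)) =
      Function.update (fun k => A k (x k)) j (A j y) := by
    funext k
    rcases eq_or_ne k j with rfl | hk
    · rw [Function.update_self, Function.update_self]
    · rw [Function.update_of_ne hk, Function.update_of_ne hk]
  rw [← Module.End.mul_apply, h.mul_mulHom _ j ⟨Y, hY⟩, h.mulHom_update, Module.End.mul_apply,
    (hA j).eq_sum _ (SetLike.coe_mem _), map_sum]
  refine Finset.sum_congr rfl fun y _ => ?_
  rw [hupd, h.mulHom_update _ j (A j y), map_smul]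
  rfl

theorem span_mulHom (h : IsUniqueGroundState 𝒜 P ψ) (hA : ∀ j, IsOrbitBasis (𝒜 j) ψ (A j))
    (hcompl : IsCompleteFamily fun j => (𝒜 j : Set (Module.End ℂ V))) :
    ⊤ ≤ Submodule.span ℂ (Set.range fun x : Cfg m => h.mulHom (fun j => A j (x j)) ψ) := by
  classical
  set w : Cfg m → V := fun x => h.mulHom (fun j => A j (x j)) ψ with hw
  have hinv (T : Module.End ℂ V) :
      ∀ v ∈ Submodule.span ℂ (Set.range w), T v ∈ Submodule.span ℂ (Set.range w) := by
    have hT : T ∈ Algebra.adjoin ℂ (⋃ j, (𝒜 j : Set (Module.End ℂ V))) := hcompl ▸ trivial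
    induction hT using Algebra.adjoin_induction with
    | mem T hT =>
      obtain ⟨j, hj⟩ := Set.mem_iUnion.1 hT
      refine fun v hv => Submodule.span_le.2 (?_ : _ ⊆ ((Submodule.span ℂ _).comap T : Set V)) hv
      rintro _ ⟨x, rfl⟩
      rw [SetLike.mem_coe, Submodule.mem_comap, hw, h.apply_mulHom hA hj]
      exact sum_mem fun y _ => Submodule.smul_mem _ _ (Submodule.subset_span ⟨_, rfl⟩)
    | algebraMap c => exact fun v hv => Submodule.smul_mem _ c hv
    | add T U _ _ hT hU => exact fun v hv => add_mem (hT v hv) (hU v hv)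
    | mul _ U _ _ hT hU => exact fun v hv => hT _ (hU v hv)
  have hψ : ψ ≠ 0 := norm_ne_zero_iff.1 (h.norm_eq_one ▸ one_ne_zero)
  have hm (j) : Nonempty (Fin (m j)) := by
    by_contra hempty
    rw [not_nonempty_iff] at hempty
    exact hψ <| by simpa using (hA j).eq_sum 1 (one_mem _)
  obtain ⟨x⟩ : Nonempty (Cfg m) := inferInstance
  intro v _
  have hv := hinv ((innerSL ℂ (w x) : V →ₗ[ℂ] ℂ).smulRight v) (w x)
    (Submodule.subset_span (Set.mem_range_self x))
  rwa [LinearMap.smulRight_apply, ContinuousLinearMap.coe_coe, innerSL_apply_apply,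
    inner_self_eq_norm_sq_to_K, (h.orthonormal_mulHom hA).1 x, RCLike.ofReal_one, one_pow,
    one_smul] at hv

end IsUniqueGroundState

theorem act_ampliate_single_basis [DecidableEq κ] (j : κ) (B : Op (Fin (m j))) (x : Cfg m) :
    act (ampliate (single m j) B) (EuclideanSpace.single x 1) =
      ∑ y, B y (x j) • EuclideanSpace.single (Function.update x j y) (1 : ℂ) := by
  ext z
  rw [act_ampliate_single, Finset.sum_eq_single (x j)]
  · simp only [WithLp.ofLp_sum, WithLp.ofLp_smul, Finset.sum_apply, Pi.smul_apply, smul_eq_mul]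
    rw [Finset.sum_eq_single (z j)]
    · simp only [PiLp.single_apply]
      congr 2
      refine propext ⟨fun h => ?_, fun h => ?_⟩
      · rw [← h, Function.update_idem, Function.update_eq_self]
      · rw [h, Function.update_idem, Function.update_eq_self]
    · intro y _ hy
      rw [PiLp.single_apply, if_neg (by rintro rfl; simp at hy), mul_zero]
    · simp
  · intro a _ ha
    rw [PiLp.single_apply, if_neg (by rintro rfl; simp at ha), mul_zero]
  · simp

end ProductBasis

theorem IsUniqueGroundState.exists_factorization {K : ℕ}
    {𝒜 : Fin K → StarSubalgebra ℂ (Module.End ℂ V)} {P : Fin K → Module.End ℂ V} {ψ : V}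
    (h : IsUniqueGroundState 𝒜 P ψ)
    (hcompl : IsCompleteFamily fun j => (𝒜 j : Set (Module.End ℂ V))) :
    ∃ (m : Fin K → ℕ) (W : V ≃ₗᵢ[ℂ] Hilb (Cfg m)), ∀ j Y, Y ∈ 𝒜 j ↔
      ∃ B : Op (Fin (m j)), ∀ v, W (Y v) = act (ampliate (single m j) B) (W v) := by
  choose m A hA using fun j => exists_isOrbitBasis (𝒜 j) ψ
  let w := OrthonormalBasis.mk (h.orthonormal_mulHom hA) (h.span_mulHom hA hcompl)
  have hfactor : ∀ j, ∀ Y ∈ 𝒜 j,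
      ∃ B : Op (Fin (m j)), ∀ v, w.repr (Y v) = act (ampliate (single m j) B) (w.repr v) := by
    intro j Y hY
    let B : Op (Fin (m j)) := Matrix.of fun y x =>
      inner ℂ ((A j y : Module.End ℂ V) ψ) (Y ((A j x : Module.End ℂ V) ψ))
    have hB : w.repr.toLinearEquiv.toLinearMap ∘ₗ Y =
        act (ampliate (single m j) B) ∘ₗ w.repr.toLinearEquiv.toLinearMap := by
      refine w.toBasis.ext fun x => ?_
      have hw (x : Cfg m) : w.repr (h.mulHom (fun k => A k (x k)) ψ) =
          EuclideanSpace.single x 1 := by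
        rw [← w.repr_self, OrthonormalBasis.coe_mk]
      have hwx : w.toBasis x = h.mulHom (fun k => A k (x k)) ψ := by
        rw [OrthonormalBasis.coe_toBasis, OrthonormalBasis.coe_mk]
      rw [hwx, LinearMap.comp_apply, h.apply_mulHom hA hY x, map_sum, LinearMap.comp_apply]
      refine (Finset.sum_congr rfl fun y _ => ?_).trans
        ((act_ampliate_single_basis j B x).symm.trans (congrArg _ (hw x).symm))
      exact (map_smul w.repr _ _).trans (congrArg _ (hw _))
    exact ⟨B, LinearMap.congr_fun hB⟩
  refine ⟨m, w.repr, fun j Y => ⟨hfactor j Y, ?_⟩⟩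
  rintro ⟨B, hB⟩
  refine mem_of_forall_ne_commute h.isCommutingFamily hcompl fun k hk Z hZ => ?_
  obtain ⟨C, hC⟩ := hfactor k Z hZ
  refine LinearMap.ext fun v => w.repr.injective ?_
  rw [Module.End.mul_apply, Module.End.mul_apply, hC, hB, hB, hC, ← act_mul, ← act_mul,
    (commute_ampliate_single hk C B).eq]

end Factorization

/-! ### Kraus maps -/

section Kraus

variable {n α β : Type} [Fintype n] [Fintype α] [Fintype β]

/-- The completely positive map `M ↦ ∑ a, K a * M * (K a)ᴴ` with Kraus operators `K a`. -/
def krausMap (K : α → Op n) : Op n →ₗ[ℂ] Op n where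
  toFun M := ∑ a, K a * M * (K a)ᴴ
  map_add' _ _ := by simp only [mul_add, add_mul, Finset.sum_add_distrib]
  map_smul' _ _ := by simp only [mul_smul_comm, smul_mul_assoc, Finset.smul_sum, RingHom.id_apply]

theorem krausMap_apply (K : α → Op n) (M : Op n) : krausMap K M = ∑ a, K a * M * (K a)ᴴ := rfl

theorem krausMap_conjTranspose (K : α → Op n) (M : Op n) : krausMap K Mᴴ = (krausMap K M)ᴴ := by
  simp only [krausMap_apply, Matrix.conjTranspose_sum, Matrix.conjTranspose_mul,
    Matrix.conjTranspose_conjTranspose, mul_assoc]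

theorem krausMap_krausMap (K : α → Op n) (K' : β → Op n) (M : Op n) :
    krausMap K (krausMap K' M) = krausMap (fun p : α × β => K p.1 * K' p.2) M := by
  simp only [krausMap_apply, Fintype.sum_prod_type, Finset.mul_sum, Finset.sum_mul,
    Matrix.conjTranspose_mul, mul_assoc]

theorem krausMap_swap (K : α × β → Op n) : krausMap (fun p : β × α => K p.swap) = krausMap K :=
  LinearMap.ext fun M => (Equiv.prodComm β α).sum_comp fun p => K p * M * (K p)ᴴ

theorem commute_krausMap {K : α → Op n} {K' : β → Op n} (h : ∀ a b, Commute (K a) (K' b)) :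
    Commute (krausMap K : Module.End ℂ (Op n)) (krausMap K') := by
  refine LinearMap.ext fun M => ?_
  rw [Module.End.mul_apply, Module.End.mul_apply, krausMap_krausMap, krausMap_krausMap,
    ← krausMap_swap fun p : β × α => K' p.1 * K p.2]
  simp only [(h _ _).eq, Prod.fst_swap, Prod.snd_swap]

variable [DecidableEq n]

theorem sum_conjTranspose_mul_krausMap_krausMap {K : α → Op n} {K' : β → Op n}
    (hK : ∑ a, (K a)ᴴ * K a = 1) (hK' : ∑ b, (K' b)ᴴ * K' b = 1) :
    ∑ p : α × β, (K p.1 * K' p.2)ᴴ * (K p.1 * K' p.2) = 1 := by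
  rw [Fintype.sum_prod_type_right, ← hK']
  refine Finset.sum_congr rfl fun b _ => ?_
  calc ∑ a, (K a * K' b)ᴴ * (K a * K' b) = (K' b)ᴴ * (∑ a, (K a)ᴴ * K a) * K' b := by
        simp only [Finset.mul_sum, Finset.sum_mul, Matrix.conjTranspose_mul, mul_assoc]
    _ = (K' b)ᴴ * K' b := by rw [hK, mul_one]

theorem isCPTP_krausMap {K : α → Op n} (hK : ∑ a, (K a)ᴴ * K a = 1) : IsCPTP (krausMap K) := by
  let e := Fintype.equivFin α
  refine ⟨Fintype.card α, fun i => K (e.symm i), ?_, fun M => ?_⟩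
  · rw [← hK]
    exact e.symm.sum_comp fun a => (K a)ᴴ * K a
  · exact (e.symm.sum_comp fun a => K a * M * (K a)ᴴ).symm

theorem IsDensity.krausMap {K : α → Op n} (hK : ∑ a, (K a)ᴴ * K a = 1) {σ : Op n}
    (hσ : IsDensity σ) : IsDensity (krausMap K σ) := by
  refine ⟨Matrix.posSemidef_sum _ fun a _ => hσ.1.mul_mul_conjTranspose_same _, ?_⟩
  calc (∑ a, K a * σ * (K a)ᴴ).trace = ((∑ a, (K a)ᴴ * K a) * σ).trace := by
        rw [Matrix.trace_sum, Finset.sum_mul, Matrix.trace_sum]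
        refine Finset.sum_congr rfl fun a _ => ?_
        rw [Matrix.trace_mul_comm, ← mul_assoc]
    _ = 1 := by rw [hK, one_mul, hσ.2]

/-- Both the range and the coimage of `M` lie in `L`, i.e. `M = P M P` for the orthogonal
projector `P` onto `L`. -/
def IsSupportedOn (L : Submodule ℂ (Hilb n)) (M : Op n) : Prop :=
  (∀ v, act M v ∈ L) ∧ ∀ v, act Mᴴ v ∈ L

variable {L L' : Submodule ℂ (Hilb n)} {M : Op n} {K : α → Op n}

theorem IsSupportedOn.mono (hM : IsSupportedOn L M) (h : L ≤ L') : IsSupportedOn L' M :=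
  ⟨fun v => h (hM.1 v), fun v => h (hM.2 v)⟩

theorem IsSupportedOn.krausMap (hM : IsSupportedOn L M) (hK : ∀ a, ∀ u ∈ L, act (K a) u ∈ L') :
    IsSupportedOn L' (krausMap K M) := by
  have hrange : ∀ M, (∀ v, act M v ∈ L) → ∀ v, act (QuasiLocal.krausMap K M) v ∈ L' := by
    intro M hM v
    simp only [krausMap_apply, act_sum, act_mul]
    exact Submodule.sum_mem _ fun a _ => hK a _ (hM _)
  exact ⟨hrange M hM.1, krausMap_conjTranspose K M ▸ hrange Mᴴ hM.2⟩

theorem IsSupportedOn.krausMap_congr {K' : α → Op n} (hM : IsSupportedOn L M)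
    (h : ∀ a, ∀ u ∈ L, act (K a) u = act (K' a) u) :
    QuasiLocal.krausMap K M = QuasiLocal.krausMap K' M := by
  have hmul : ∀ a M, (∀ v, act M v ∈ L) → K a * M = K' a * M := fun a M hM =>
    op_ext fun v => by rw [act_mul, act_mul, h a _ (hM v)]
  refine Finset.sum_congr rfl fun a _ => ?_
  calc K a * M * (K a)ᴴ = K' a * (K a * Mᴴ)ᴴ := by
        rw [hmul a M hM.1, Matrix.conjTranspose_mul, Matrix.conjTranspose_conjTranspose, mul_assoc]
    _ = K' a * M * (K' a)ᴴ := by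
        rw [hmul a Mᴴ hM.2, Matrix.conjTranspose_mul, Matrix.conjTranspose_conjTranspose,
          mul_assoc]

theorem IsSupportedOn.krausMap_comm {K' : β → Op n} (hM : IsSupportedOn L M)
    (h : ∀ a b, ∀ u ∈ L, act (K a) (act (K' b) u) = act (K' b) (act (K a) u)) :
    QuasiLocal.krausMap K (QuasiLocal.krausMap K' M) =
      QuasiLocal.krausMap K' (QuasiLocal.krausMap K M) := by
  rw [krausMap_krausMap, krausMap_krausMap, ← krausMap_swap fun p : β × α => K' p.1 * K p.2]
  exact hM.krausMap_congr fun p u hu => by rw [act_mul, act_mul]; exact h p.1 p.2 u hu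

end Kraus

/-! ### Pure states -/

section PureStates

variable {n α : Type} [Fintype n] [DecidableEq n] [Fintype α] {K : α → Op n} {φ ψ : Hilb n}

theorem act_ketbra (ψ v : Hilb n) : act (ketbra ψ) v = inner ℂ ψ v • ψ := by
  ext a
  simp only [act_apply, ketbra, Matrix.of_apply, WithLp.ofLp_smul, Pi.smul_apply, smul_eq_mul,
    PiLp.inner_apply, RCLike.inner_apply, Finset.sum_mul, starRingEnd_apply]
  exact Finset.sum_congr rfl fun b _ => by ring

omit [DecidableEq n] in
theorem isDensity_ketbra (hψ : ‖ψ‖ = 1) : IsDensity (ketbra ψ) := by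
  refine ⟨Matrix.posSemidef_vecMulVec_self_star (ψ : n → ℂ), ?_⟩
  calc (ketbra ψ).trace = ((∑ i, ‖ψ i‖ ^ 2 : ℝ) : ℂ) := by
        simp only [Matrix.trace, Matrix.diag, ketbra, Matrix.of_apply, Complex.ofReal_sum,
          Complex.star_def, Complex.mul_conj, Complex.normSq_eq_norm_sq]
    _ = 1 := by rw [← EuclideanSpace.norm_sq_eq, hψ]; norm_num

omit [DecidableEq n] in
theorem eq_smul_of_ketbra_eq (hφ : ‖φ‖ = 1) (h : ketbra φ = ketbra ψ) : φ = inner ℂ ψ φ • ψ := by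
  classical
  rw [← act_ketbra, ← h, act_ketbra, inner_self_eq_norm_sq_to_K, hφ]
  simp

theorem IsDensity.eq_ketbra (hψ : ‖ψ‖ = 1) {σ : Op n} (hσ : IsDensity σ)
    (h : ∀ v, ∃ c : ℂ, act σ v = c • ψ) : σ = ketbra ψ := by
  have hψψ : inner ℂ ψ ψ = (1 : ℂ) := by simp [inner_self_eq_norm_sq_to_K, hψ]
  have hσψ : ∀ v, act σ v = inner ℂ ψ (act σ v) • ψ := by
    intro v
    obtain ⟨c, hc⟩ := h v
    rw [hc, inner_smul_right, hψψ, mul_one]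
  obtain ⟨c, hc⟩ := h ψ
  have hσc : σ = starRingEnd ℂ c • ketbra ψ := op_ext fun v => by
    rw [hσψ, act_smul, act_ketbra, inner_act_right, hσ.1.isHermitian.eq, hc, inner_smul_left,
      smul_smul]
  have htr := hσ.2
  rw [hσc, Matrix.trace_smul, (isDensity_ketbra hψ).2, smul_eq_mul, mul_one] at htr
  rw [hσc, htr, one_smul]

theorem krausMap_ketbra (K : α → Op n) (ψ : Hilb n) :
    krausMap K (ketbra ψ) = ∑ a, ketbra (act (K a) ψ) := by
  refine Finset.sum_congr rfl fun a _ => op_ext fun v => ?_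
  rw [act_mul, act_mul, act_ketbra, act_ketbra, map_smul, inner_act_left]

theorem krausMap_ketbra_eq_self (hK : ∑ a, (K a)ᴴ * K a = 1) {c : α → ℂ}
    (h : ∀ a, act (K a) φ = c a • φ) : krausMap K (ketbra φ) = ketbra φ := by
  rcases eq_or_ne φ 0 with rfl | hφ
  · have hzero : ketbra (0 : Hilb n) = 0 := op_ext fun v => by simp [act_ketbra]
    rw [hzero, map_zero]
  have hsum : ∑ a, starRingEnd ℂ (c a) * c a = 1 := by
    refine mul_right_cancel₀ (inner_self_ne_zero.2 hφ) ?_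
    calc (∑ a, starRingEnd ℂ (c a) * c a) * inner ℂ φ φ
        = ∑ a, inner ℂ φ (act ((K a)ᴴ * K a) φ) := by
          rw [Finset.sum_mul]
          refine Finset.sum_congr rfl fun a _ => ?_
          rw [act_mul, ← inner_act_left, h, inner_smul_left, inner_smul_right, mul_assoc]
      _ = 1 * inner ℂ φ φ := by rw [← inner_sum, ← act_sum, hK, act_one, one_mul]
  refine op_ext fun v => ?_
  simp only [krausMap_ketbra, act_sum, act_ketbra, h, inner_smul_left, smul_smul,
    mul_right_comm _ (inner ℂ φ v), ← Finset.sum_smul, ← Finset.sum_mul, hsum, one_mul]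

/-- A pure state is extremal, so each Kraus operator of a map that fixes it maps it to a multiple
of itself. -/
theorem exists_act_eq_smul_of_krausMap_ketbra (hψ : ‖ψ‖ = 1)
    (h : krausMap K (ketbra ψ) = ketbra ψ) (a : α) : ∃ c : ℂ, act (K a) ψ = c • ψ := by
  set v := act (K a) ψ - inner ℂ ψ (act (K a) ψ) • ψ with hv
  have hvψ : inner ℂ ψ v = (0 : ℂ) := by
    rw [hv, inner_sub_right, inner_smul_right, inner_self_eq_norm_sq_to_K, hψ]
    simp
  have hsum : ∑ b, ‖inner ℂ (act (K b) ψ) v‖ ^ 2 = 0 := by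
    have hval := congrArg (fun X => inner ℂ v (act X v)) h
    simp only [krausMap_ketbra, act_sum, act_ketbra, inner_sum, inner_smul_right, hvψ,
      zero_mul] at hval
    simp only [← inner_conj_symm v, RCLike.mul_conj] at hval
    exact RCLike.ofReal_eq_zero.1 (by exact_mod_cast hval)
  have hKv : inner ℂ (act (K a) ψ) v = 0 := by
    simpa using (Finset.sum_eq_zero_iff_of_nonneg fun b _ => sq_nonneg _).1 hsum a
      (Finset.mem_univ a)
  have hvv : inner ℂ v v = (0 : ℂ) := by
    nth_rw 1 [hv]
    rw [inner_sub_left, hKv, inner_smul_left, hvψ, mul_zero, sub_zero]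
  exact ⟨_, sub_eq_zero.1 (inner_self_eq_zero.1 hvv)⟩

end PureStates

/-! ### Neighborhood maps -/

section TensorId

variable {A B C α : Type} [Fintype A] [Finite B] [Fintype C] [Fintype α] [DecidableEq B]
  (e : C ≃ A × B)

theorem isTensorId_krausMap (K : α → Op A) :
    IsTensorId e (krausMap fun a => ampliate e (K a)) (krausMap K) := by
  have := Fintype.ofFinite B
  intro M a a' b b'
  simp only [krausMap_apply, Matrix.sum_apply]
  refine Finset.sum_congr rfl fun i _ => ?_
  rw [← ampliate_conjTranspose, Matrix.mul_apply, Matrix.mul_apply, ← Equiv.sum_comp e.symm,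
    Fintype.sum_prod_type]
  refine Finset.sum_congr rfl fun x _ => ?_
  simp only [ampliate_apply, Equiv.apply_symm_apply, mul_ite, mul_one, mul_zero,
    Finset.sum_ite_eq', Finset.mem_univ, if_true]
  congr 1
  rw [Matrix.mul_apply, Matrix.mul_apply, ← Equiv.sum_comp e.symm, Fintype.sum_prod_type]
  simp [ampliate_apply]

theorem sum_conjTranspose_ampliate_mul [DecidableEq A] [DecidableEq C] {X : α → Op A}
    (hX : ∑ a, (X a)ᴴ * X a = 1) :
    ∑ a, (ampliate e (X a))ᴴ * ampliate e (X a) = 1 := by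
  simp only [← ampliate_conjTranspose, ← ampliate_mul]
  rw [← ampliate_sum, hX, ampliate_one]

end TensorId

theorem IsTensorId.unique {A B C : Type} {e : C ≃ A × B} {E E' : Op C →ₗ[ℂ] Op C}
    {F : Op A →ₗ[ℂ] Op A} (h : IsTensorId e E F) (h' : IsTensorId e E' F) : E = E' := by
  ext M x y
  simpa using (h M (e x).1 (e y).1 (e x).2 (e y).2).trans
    (h' M (e x).1 (e y).1 (e x).2 (e y).2).symm

section NeighborhoodMaps

variable {N K : ℕ} {d : Fin N → ℕ} {nbhd : Fin K → Finset (Fin N)} {ψ u : Hilb (Cfg d)}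
  {S : Finset (Fin N)} {E E' : Op (Cfg d) →ₗ[ℂ] Op (Cfg d)}

theorem IsNeighborhoodMap.exists_kraus (hE : IsNeighborhoodMap d S E) :
    ∃ (r : ℕ) (X : Fin r → Op (SubCfg d S)),
      ∑ a, (X a)ᴴ * X a = 1 ∧ E = krausMap fun a => ampliate (split d S) (X a) := by
  obtain ⟨F, ⟨r, X, hX, hF⟩, hEF⟩ := hE
  obtain rfl : F = krausMap X := LinearMap.ext hF
  exact ⟨r, X, hX, hEF.unique (isTensorId_krausMap _ X)⟩

theorem isNeighborhoodMap_krausMap {α : Type} [Fintype α] {X : α → Op (SubCfg d S)}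
    (hX : ∑ a, (X a)ᴴ * X a = 1) :
    IsNeighborhoodMap d S (krausMap fun a => ampliate (split d S) (X a)) :=
  ⟨krausMap X, isCPTP_krausMap hX, isTensorId_krausMap _ X⟩

theorem IsNeighborhoodMap.isDensity (hE : IsNeighborhoodMap d S E) {σ : Op (Cfg d)}
    (hσ : IsDensity σ) : IsDensity (E σ) := by
  obtain ⟨r, X, hX, rfl⟩ := hE.exists_kraus
  exact hσ.krausMap (sum_conjTranspose_ampliate_mul _ hX)

variable (d S) in
theorem isNeighborhoodMap_one : IsNeighborhoodMap d S (1 : Module.End ℂ (Op (Cfg d))) := by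
  convert isNeighborhoodMap_krausMap (d := d) (S := S) (X := fun _ : Unit => 1) (by simp)
  exact LinearMap.ext fun M => by simp [krausMap_apply, ampliate_one]

theorem IsNeighborhoodMap.mul {E E' : Module.End ℂ (Op (Cfg d))} (hE : IsNeighborhoodMap d S E)
    (hE' : IsNeighborhoodMap d S E') : IsNeighborhoodMap d S (E * E') := by
  obtain ⟨r, X, hX, rfl⟩ := hE.exists_kraus
  obtain ⟨r', X', hX', rfl⟩ := hE'.exists_kraus
  convert isNeighborhoodMap_krausMap (S := S) (sum_conjTranspose_mul_krausMap_krausMap hX hX')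
  refine LinearMap.ext fun M => ?_
  rw [Module.End.mul_apply, krausMap_krausMap]
  simp only [ampliate_mul]

theorem IsNeighborhoodMap.map_ketbra_eq_self (hψ : ‖ψ‖ = 1) (hE : IsNeighborhoodMap d S E)
    (hEψ : E (ketbra ψ) = ketbra ψ) (hu : act (schmidtProj d ψ S) u = u) :
    E (ketbra u) = ketbra u := by
  obtain ⟨r, X, hX, rfl⟩ := hE.exists_kraus
  choose c hc using exists_act_eq_smul_of_krausMap_ketbra hψ hEψ
  have hspan : ∀ a, schmidtSpan (split d S) ψ ≤ LinearMap.eqLocus (act (X a)) (c a • .id) := by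
    refine fun a => Submodule.span_le.2 ?_
    rintro _ ⟨b, rfl⟩
    exact (slice_act_ampliate _ _ _ _).symm.trans (congrArg (slice _ · b) (hc a))
  refine krausMap_ketbra_eq_self (sum_conjTranspose_ampliate_mul _ hX) (c := c) fun a =>
    slice_ext (split d S) fun b => ?_
  rw [slice_act_ampliate, slice_smul]
  exact hspan a ((act_ampliate_proj_eq_self_iff _).1 hu b)

end NeighborhoodMaps

/-! ### Quasi-locally stabilizable pure states -/

section Stabilizable

variable {n : Type}

theorem applyMaps_eq_self {L : List (Op n →ₗ[ℂ] Op n)} {σ : Op n} (h : ∀ E ∈ L, E σ = σ) :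
    applyMaps L σ = σ := by
  induction L with
  | nil => rfl
  | cons E L ih =>
    rw [applyMaps, List.foldl_cons, h E List.mem_cons_self]
    exact ih fun E' hE' => h E' (List.mem_cons_of_mem _ hE')

theorem IsGAS.eq_of_map_eq_self [Fintype n] {ρ σ : Op n} {E : ℕ → Op n →ₗ[ℂ] Op n}
    (h : IsGAS ρ E) (hσ : IsDensity σ) (hfix : ∀ t, E t σ = σ) : σ = ρ := by
  have hconst : ∀ k, applyMaps ((List.range k).map fun i => E (0 + i)) σ = σ := fun k =>
    applyMaps_eq_self <| List.forall_mem_map.2 fun i _ => hfix _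
  simpa only [hconst, tendsto_const_nhds_iff] using h.2 σ hσ 0

variable {N K : ℕ} {d : Fin N → ℕ} {nbhd : Fin K → Finset (Fin N)} {ψ u : Hilb (Cfg d)}

theorem IsQLS.pos {ρ : Op (Cfg d)} (h : IsQLS d nbhd ρ) : 0 < K := by
  obtain ⟨E, hE, -⟩ := h
  obtain ⟨k, -⟩ := hE 0
  exact k.pos

theorem IsQLS.eq_smul (hψ : ‖ψ‖ = 1) (h : IsQLS d nbhd (ketbra ψ))
    (hu : ∀ k, act (schmidtProj d ψ (nbhd k)) u = u) : ∃ c : ℂ, u = c • ψ := by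
  obtain ⟨E, hE, hGAS⟩ := h
  rcases eq_or_ne u 0 with rfl | hu0
  · exact ⟨0, by simp⟩
  set w := (‖u‖ : ℂ)⁻¹ • u with hw
  have hnorm : ‖w‖ = 1 := norm_smul_inv_norm hu0
  have huw : u = (‖u‖ : ℂ) • w := by simp [hw, smul_smul, hu0]
  have hwψ : ketbra w = ketbra ψ := hGAS.eq_of_map_eq_self (isDensity_ketbra hnorm) fun t => by
    obtain ⟨k, hk⟩ := hE t
    exact hk.map_ketbra_eq_self hψ (hGAS.1 t) (by rw [hw, map_smul, hu])
  refine ⟨‖u‖ * inner ℂ ψ w, ?_⟩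
  rw [← smul_smul, ← eq_smul_of_ketbra_eq hnorm hwψ]
  exact huw

end Stabilizable

/-! ### Product vectors and induced factorizations -/

section ProductVectors

variable {ι : Type} [Fintype ι] {m : ι → ℕ}

theorem prodVec_smul (c : ι → ℂ) (v : ∀ j, Hilb (Fin (m j))) :
    prodVec (fun j => c j • v j) = (∏ j, c j) • prodVec v := by
  ext y
  simp [prodVec_apply, Finset.prod_mul_distrib]

theorem exists_eq_smul_prodVec_of_mem_tensorSubspace {v : ∀ j, Hilb (Fin (m j))}
    {x : Hilb (Cfg m)} (hx : x ∈ tensorSubspace fun j => Submodule.span ℂ {v j}) :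
    ∃ c : ℂ, x = c • prodVec v := by
  suffices h : tensorSubspace (fun j => Submodule.span ℂ {v j}) ≤
      Submodule.span ℂ {prodVec v} by
    obtain ⟨c, hc⟩ := Submodule.mem_span_singleton.1 (h hx)
    exact ⟨c, hc.symm⟩
  refine Submodule.span_le.2 ?_
  rintro _ ⟨u, hu, rfl⟩
  choose c hc using fun j => Submodule.mem_span_singleton.1 (hu j)
  rw [← funext hc, prodVec_smul]
  exact Submodule.smul_mem _ _ (Submodule.mem_span_singleton_self _)

variable [DecidableEq ι]

theorem exists_norm_eq_one_prodVec_eq [Nonempty ι] {v : ∀ j, Hilb (Fin (m j))} {c : ℂ}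
    (h : ‖c • prodVec v‖ = 1) :
    ∃ φ : ∀ j, Hilb (Fin (m j)), (∀ j, ‖φ j‖ = 1) ∧ prodVec φ = c • prodVec v := by
  obtain ⟨j₀⟩ := ‹Nonempty ι›
  rw [norm_smul, norm_prodVec] at h
  have hprod : ∏ j, ‖v j‖ ≠ 0 := right_ne_zero_of_mul (h ▸ one_ne_zero)
  have hv : ∀ j, ‖v j‖ ≠ 0 := fun j => Finset.prod_ne_zero_iff.1 hprod j (Finset.mem_univ j)
  let γ : ι → ℂ := Pi.mulSingle j₀ (c * (∏ j, ‖v j‖ : ℝ))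
  have hγ : ∀ j, ‖γ j‖ = 1 := fun j => by
    rcases eq_or_ne j j₀ with rfl | hj
    · rw [show γ j = _ from Pi.mulSingle_eq_same .., norm_mul, Complex.norm_real, Real.norm_eq_abs,
        abs_of_nonneg (Finset.prod_nonneg fun j _ => norm_nonneg _), h]
    · rw [show γ j = 1 from Pi.mulSingle_eq_of_ne hj _, norm_one]
  refine ⟨fun j => (γ j * (‖v j‖ : ℂ)⁻¹) • v j, fun j => ?_, ?_⟩
  · rw [norm_smul, norm_mul, hγ, one_mul, norm_inv, Complex.norm_real, norm_norm,
      inv_mul_cancel₀ (hv j)]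
  · rw [prodVec_smul, Finset.prod_mul_distrib, Finset.prod_inv_distrib, ← Complex.ofReal_prod,
      Finset.prod_pi_mulSingle', if_pos (Finset.mem_univ _),
      mul_inv_cancel_right₀ (Complex.ofReal_ne_zero.2 hprod)]

theorem exists_forall_slice_mem_span_singleton {x : Hilb (Cfg m)} (hx : ‖x‖ = 1) {j : ι}
    {P : Op (Fin (m j))}
    (hP : ∀ C : Op (Fin (m j)), act (ampliate (single m j) P) (act (ampliate (single m j) C) x) =
      (inner ℂ x (act (ampliate (single m j) C) x) : ℂ) • x) :
    ∃ v : Hilb (Fin (m j)), ∀ b, slice (single m j) x b ∈ Submodule.span ℂ {v} := by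
  let C (a : Fin (m j)) : Op (Fin (m j)) := ketBasis (EuclideanSpace.single a 1) a
  have hC : ∑ a, C a = 1 := op_ext fun v => by
    ext b
    rw [act_sum, act_one]
    simp [C, act_ketBasis, Pi.single_apply]
  obtain ⟨a, ha⟩ : ∃ a, inner ℂ x (act (ampliate (single m j) (C a)) x) ≠ (0 : ℂ) := by
    by_contra! h
    have hsum : ∑ a, inner ℂ x (act (ampliate (single m j) (C a)) x) = (1 : ℂ) := by
      rw [← inner_sum, ← act_sum, ← ampliate_sum, hC, ampliate_one, act_one,
        inner_self_eq_norm_sq_to_K, hx, RCLike.ofReal_one, one_pow]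
    simp [h] at hsum
  refine ⟨act P (EuclideanSpace.single a 1), fun b => ?_⟩
  have hslice := congrArg (fun w => slice (single m j) w b) (hP (C a))
  simp only [slice_smul, slice_act_ampliate, C, act_ketBasis, map_smul] at hslice
  rw [← Submodule.smul_mem_iff _ ha, ← hslice]
  exact Submodule.smul_mem _ _ (Submodule.mem_span_singleton_self _)

theorem exists_prodVec_eq [Nonempty ι] {x : Hilb (Cfg m)} (hx : ‖x‖ = 1)
    (h : ∀ j, ∃ P : Op (Fin (m j)), ∀ C : Op (Fin (m j)),
      act (ampliate (single m j) P) (act (ampliate (single m j) C) x) =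
        (inner ℂ x (act (ampliate (single m j) C) x) : ℂ) • x) :
    ∃ φ : ∀ j, Hilb (Fin (m j)), (∀ j, ‖φ j‖ = 1) ∧ prodVec φ = x := by
  choose P hP using h
  choose v hv using fun j => exists_forall_slice_mem_span_singleton hx (hP j)
  obtain ⟨c, rfl⟩ := exists_eq_smul_prodVec_of_mem_tensorSubspace (v := v)
    (mem_tensorSubspace_iff.2 fun j => (act_ampliate_proj_eq_self_iff _).2 (hv j))
  exact exists_norm_eq_one_prodVec_eq hx

end ProductVectors

theorem exists_apply_eq_act {V n : Type} [NormedAddCommGroup V] [InnerProductSpace ℂ V] [Fintype n]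
    [DecidableEq n] (W : V ≃ₗᵢ[ℂ] Hilb n) (X : Op n) :
    ∃ Y : Module.End ℂ V, ∀ v, W (Y v) = act X (W v) :=
  ⟨W.symm.toLinearEquiv.toLinearMap ∘ₗ act X ∘ₗ W.toLinearEquiv.toLinearMap,
    fun _ => W.apply_symm_apply _⟩

theorem IsUniqueGroundState.exists_prodVec {V ι : Type} [NormedAddCommGroup V]
    [InnerProductSpace ℂ V] [FiniteDimensional ℂ V] [Fintype ι] [DecidableEq ι] [Nonempty ι]
    {𝒜 : ι → StarSubalgebra ℂ (Module.End ℂ V)} {P : ι → Module.End ℂ V} {ψ : V}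
    (h : IsUniqueGroundState 𝒜 P ψ) {m : ι → ℕ} {W : V ≃ₗᵢ[ℂ] Hilb (Cfg m)}
    (hW : ∀ j Y, Y ∈ 𝒜 j ↔ ∃ B : Op (Fin (m j)), ∀ v,
      W (Y v) = act (ampliate (single m j) B) (W v)) :
    ∃ φ : ∀ j, Hilb (Fin (m j)), (∀ j, ‖φ j‖ = 1) ∧ prodVec φ = W ψ := by
  refine exists_prodVec_eq (by rw [W.norm_map, h.norm_eq_one]) fun j => ?_
  obtain ⟨P', hP'⟩ := (hW j _).1 (h.proj_mem j)
  refine ⟨P', fun C => ?_⟩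
  obtain ⟨Y, hY⟩ := exists_apply_eq_act W (ampliate (single m j) C)
  rw [← hY, ← hP', h.proj_apply_apply ((hW j Y).2 ⟨C, hY⟩), map_smul, W.inner_map_map]

section Induced

variable {N K : ℕ} {d : Fin N → ℕ} {nbhd : Fin K → Finset (Fin N)} {ψ : Hilb (Cfg d)}

variable (d ψ) in
/-- The vector `ψ`, as an element of its local support. -/
def localVec : localSupport d ψ := ⟨ψ, self_mem_localSupport d ψ⟩

theorem localSchmidtProj_mem (hcomm : IsCommutingFamily (restrictedAlgebra d nbhd ψ))
    (hcompl : IsCompleteFamily (restrictedAlgebra d nbhd ψ)) (j : Fin K) :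
    localSchmidtProj d ψ (nbhd j) ∈ restrictedAlgebra d nbhd ψ j :=
  @mem_of_forall_ne_commute (localSupport d ψ) inferInstance inferInstance inferInstance
    (Fin K) (restrictedStarSubalgebra d nbhd ψ) hcomm hcompl j _
    fun _ hk _ hY => commute_localSchmidtProj hk.symm hY

theorem isUniqueGroundState_localVec (hψ : ‖ψ‖ = 1) (hQLS : IsQLS d nbhd (ketbra ψ))
    (hcomm : IsCommutingFamily (restrictedAlgebra d nbhd ψ))
    (hcompl : IsCompleteFamily (restrictedAlgebra d nbhd ψ)) :
    IsUniqueGroundState (V := localSupport d ψ) (restrictedStarSubalgebra d nbhd ψ)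
      (fun j => localSchmidtProj d ψ (nbhd j)) (localVec d ψ) where
  isCommutingFamily := hcomm
  proj_mem := localSchmidtProj_mem hcomm hcompl
  isStarProjection j := isStarProjection_localSchmidtProj (nbhd j)
  norm_eq_one := hψ
  proj_apply j := Subtype.ext (act_schmidtProj_self (nbhd j))
  exists_eq_smul u hu := by
    obtain ⟨c, hc⟩ := hQLS.eq_smul hψ fun k => congrArg Subtype.val (hu k)
    exact ⟨c, Subtype.ext hc⟩

theorem exists_isInducedFactorization (hψ : ‖ψ‖ = 1) (hQLS : IsQLS d nbhd (ketbra ψ))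
    (hcomm : IsCommutingFamily (restrictedAlgebra d nbhd ψ))
    (hcompl : IsCompleteFamily (restrictedAlgebra d nbhd ψ)) :
    ∃ (m : Fin K → ℕ) (W : localSupport d ψ ≃ₗᵢ[ℂ] Hilb (Cfg m)),
      IsInducedFactorization d nbhd ψ m W :=
  (isUniqueGroundState_localVec hψ hQLS hcomm hcompl).exists_factorization hcompl

theorem IsInducedFactorization.exists_prodVec (hψ : ‖ψ‖ = 1) (hQLS : IsQLS d nbhd (ketbra ψ))
    (hcomm : IsCommutingFamily (restrictedAlgebra d nbhd ψ))
    (hcompl : IsCompleteFamily (restrictedAlgebra d nbhd ψ)) {m : Fin K → ℕ}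
    {W : localSupport d ψ ≃ₗᵢ[ℂ] Hilb (Cfg m)} (hW : IsInducedFactorization d nbhd ψ m W) :
    ∃ φ : ∀ j, Hilb (Fin (m j)), (∀ j, ‖φ j‖ = 1) ∧ prodVec φ = W (localVec d ψ) :=
  have : Nonempty (Fin K) := ⟨⟨0, hQLS.pos⟩⟩
  (isUniqueGroundState_localVec hψ hQLS hcomm hcompl).exists_prodVec hW

end Induced

/-! ### Conditional Kraus operators and resets -/

section ConditionalKraus

variable {n α : Type} [Fintype n] [DecidableEq n]

/-- The Kraus operators of the map that applies `K` on the range of the projector `P` and leaves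
the kernel of `P` alone. -/
def conditionalKraus (P : Op n) (K : α → Op n) : Option α → Op n
  | none => 1 - P
  | some a => K a * P

variable {P : Op n} {K : α → Op n} {v : Hilb n}

theorem act_conditionalKraus_of_eq_self (hv : act P v = v) (a : Option α) :
    act (conditionalKraus P K a) v = a.elim 0 fun a => act (K a) v := by
  cases a with
  | none => rw [conditionalKraus, act_sub, act_one, hv, sub_self]; rfl
  | some a => rw [conditionalKraus, act_mul, hv]; rfl

theorem act_conditionalKraus_of_eq_zero (hv : act P v = 0) (a : Option α) :
    act (conditionalKraus P K a) v = a.elim v fun _ => 0 := by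
  cases a with
  | none => rw [conditionalKraus, act_sub, act_one, hv, sub_zero]; rfl
  | some a => rw [conditionalKraus, act_mul, hv, map_zero]; rfl

theorem sum_conjTranspose_conditionalKraus_mul [Fintype α] (hP : P * P = P) (hP' : Pᴴ = P)
    (hK : (∑ a, (K a)ᴴ * K a) * P = P) :
    ∑ a, (conditionalKraus P K a)ᴴ * conditionalKraus P K a = 1 := by
  have hsome : ∑ a, (K a * P)ᴴ * (K a * P) = P := by
    calc ∑ a, (K a * P)ᴴ * (K a * P) = P * ((∑ a, (K a)ᴴ * K a) * P) := by
          simp only [Matrix.conjTranspose_mul, hP', Finset.sum_mul, Finset.mul_sum, mul_assoc]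
      _ = P := by rw [hK, hP]
  have hnone : (1 - P)ᴴ * (1 - P) = 1 - P := by
    rw [Matrix.conjTranspose_sub, Matrix.conjTranspose_one, hP', mul_sub, mul_one, sub_mul, one_mul,
      hP, sub_self, sub_zero]
  rw [Fintype.sum_option]
  simp only [conditionalKraus, hsome, hnone, sub_add_cancel]

theorem ampliate_conditionalKraus {A B C : Type} [Fintype A] [DecidableEq A] [Finite B]
    [DecidableEq B] [Fintype C] [DecidableEq C] (e : C ≃ A × B) (P : Op A) (K : α → Op A)
    (a : Option α) : ampliate e (conditionalKraus P K a) =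
      conditionalKraus (ampliate e P) (fun a => ampliate e (K a)) a := by
  cases a with
  | none => rw [conditionalKraus, ampliate_sub, ampliate_one]; rfl
  | some a => rw [conditionalKraus, ampliate_mul]; rfl

theorem isSupportedOn_ketbra {L : Submodule ℂ (Hilb n)} (hv : v ∈ L) :
    IsSupportedOn L (ketbra v) := by
  have hrange : ∀ u, act (ketbra v) u ∈ L := fun u => by
    rw [act_ketbra]; exact L.smul_mem _ hv
  refine ⟨hrange, ?_⟩
  have hherm : (ketbra v)ᴴ = ketbra v :=
    (Matrix.posSemidef_vecMulVec_self_star (v : n → ℂ)).isHermitian.eq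
  rwa [hherm]

end ConditionalKraus

section Resets

variable {N : ℕ} {d : Fin N → ℕ} {ψ : Hilb (Cfg d)} {τ : ∀ i, Hilb (Fin (d i))}
  {S : Finset (Fin N)} {i k : Fin N}

/-- The reset of the site `i`: it prepares the state `τ i` at the site `i` when this site is
outside of its local support, and does nothing otherwise. -/
def siteReset (d : Fin N → ℕ) (ψ : Hilb (Cfg d)) (τ : ∀ i, Hilb (Fin (d i))) (i : Fin N) :
    Module.End ℂ (Op (Cfg d)) :=
  krausMap fun c => ampliate (single d i)
    (conditionalKraus (1 - proj (siteSupport d ψ i)) (ketBasis (τ i)) c)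

theorem isSupportedOn_siteReset (hτ : τ i ∈ siteSupport d ψ i) (M : Op (Cfg d)) :
    IsSupportedOn (fixedSpace (siteProj d ψ i)) (siteReset d ψ τ i M) := by
  have hM : IsSupportedOn ⊤ M := ⟨fun _ => trivial, fun _ => trivial⟩
  refine hM.krausMap fun c u _ => ?_
  have hproj : proj (siteSupport d ψ i) *
      conditionalKraus (1 - proj (siteSupport d ψ i)) (ketBasis (τ i)) c =
      conditionalKraus (1 - proj (siteSupport d ψ i)) (ketBasis (τ i)) c := by
    cases c with
    | none => rw [conditionalKraus, sub_sub_cancel, proj_mul_self]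
    | some c =>
      rw [conditionalKraus, ← mul_assoc]
      congr 1
      exact op_ext fun v => by
        rw [act_mul, act_ketBasis, map_smul, act_proj_eq_self_iff.2 hτ]
  rw [mem_fixedSpace, siteProj, ← act_mul, ← ampliate_mul, hproj]

theorem siteReset_eq_self {M : Op (Cfg d)} (hM : IsSupportedOn (fixedSpace (siteProj d ψ i)) M) :
    siteReset d ψ τ i M = M := by
  have hcongr : siteReset d ψ τ i M = krausMap
      (fun c : Option (Fin (d i)) => c.elim (1 : Op (Cfg d)) fun _ => 0) M := by
    refine hM.krausMap_congr fun c u hu => ?_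
    rw [ampliate_conditionalKraus, act_conditionalKraus_of_eq_zero]
    · cases c <;> simp
    · rw [ampliate_sub, ampliate_one, act_sub, act_one, ← siteProj, mem_fixedSpace.1 hu, sub_self]
  rw [hcongr, krausMap_apply, Fintype.sum_option]
  simp

theorem siteReset_mul_self (hτ : τ i ∈ siteSupport d ψ i) :
    siteReset d ψ τ i * siteReset d ψ τ i = siteReset d ψ τ i := by
  refine LinearMap.ext fun M => ?_
  rw [Module.End.mul_apply, siteReset_eq_self (isSupportedOn_siteReset hτ M)]

theorem siteReset_ketbra (i : Fin N) : siteReset d ψ τ i (ketbra ψ) = ketbra ψ :=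
  siteReset_eq_self (isSupportedOn_ketbra (act_siteProj_self i))

theorem pairwise_commute_siteReset : Pairwise (Function.onFun Commute (siteReset d ψ τ)) :=
  fun _ _ h => commute_krausMap fun _ _ => commute_ampliate_single h _ _

theorem isNeighborhoodMap_siteReset (hτ : ‖τ i‖ = 1) (hi : i ∈ S) :
    IsNeighborhoodMap d S (siteReset d ψ τ i) := by
  rw [siteReset]
  simp only [ampliate_single_of_mem hi]
  refine isNeighborhoodMap_krausMap <| sum_conjTranspose_ampliate_mul _ <|
    sum_conjTranspose_conditionalKraus_mul ?_ ?_ ?_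
  · rw [mul_sub, mul_one, sub_mul, one_mul, proj_mul_self, sub_self, sub_zero]
  · rw [Matrix.conjTranspose_sub, Matrix.conjTranspose_one, conjTranspose_proj]
  · rw [sum_conjTranspose_ketBasis_mul hτ, one_mul]

theorem IsNeighborhoodMap.commute_siteReset {E : Module.End ℂ (Op (Cfg d))}
    (hE : IsNeighborhoodMap d S E) (hi : i ∉ S) : Commute E (siteReset d ψ τ i) := by
  obtain ⟨r, X, -, rfl⟩ := hE.exists_kraus
  exact commute_krausMap fun a c => commute_ampliate_split_single hi _ _

/-- The resets of all sites in `S`. -/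
def resets (d : Fin N → ℕ) (ψ : Hilb (Cfg d)) (τ : ∀ i, Hilb (Fin (d i)))
    (S : Finset (Fin N)) : Module.End ℂ (Op (Cfg d)) :=
  S.noncommProd (siteReset d ψ τ) (pairwise_commute_siteReset.set_pairwise _)

theorem siteReset_mul_resets (hτ : τ i ∈ siteSupport d ψ i) (hi : i ∈ S) :
    siteReset d ψ τ i * resets d ψ τ S = resets d ψ τ S := by
  rw [resets, ← Finset.mul_noncommProd_erase S hi, ← mul_assoc, siteReset_mul_self hτ]

theorem commute_siteReset (i k : Fin N) : Commute (siteReset d ψ τ i) (siteReset d ψ τ k) := by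
  rcases eq_or_ne i k with rfl | hik
  · exact Commute.refl _
  · exact pairwise_commute_siteReset hik

theorem commute_resets {E : Module.End ℂ (Op (Cfg d))}
    (h : ∀ i ∈ S, Commute E (siteReset d ψ τ i)) : Commute E (resets d ψ τ S) :=
  Finset.noncommProd_commute _ _ _ _ h

theorem commute_siteReset_resets (i : Fin N) :
    Commute (siteReset d ψ τ i) (resets d ψ τ S) :=
  commute_resets fun k _ => commute_siteReset i k

theorem resets_mul_siteReset (hτ : τ i ∈ siteSupport d ψ i) (hi : i ∈ S) :
    resets d ψ τ S * siteReset d ψ τ i = resets d ψ τ S :=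
  (commute_siteReset_resets i).eq.symm.trans (siteReset_mul_resets hτ hi)

theorem isNeighborhoodMap_resets (hτ : ∀ i, ‖τ i‖ = 1) :
    IsNeighborhoodMap d S (resets d ψ τ S) :=
  Finset.noncommProd_induction _ _ _ (IsNeighborhoodMap d S) (fun _ _ => .mul)
    (isNeighborhoodMap_one d S) fun _ hi => isNeighborhoodMap_siteReset (hτ _) hi

theorem isSupportedOn_partialSupport_iff {M : Op (Cfg d)} :
    IsSupportedOn (partialSupport d ψ S) M ↔
      ∀ i ∈ S, IsSupportedOn (fixedSpace (siteProj d ψ i)) M := by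
  simp only [IsSupportedOn, mem_partialSupport_iff, mem_fixedSpace]
  exact ⟨fun h i hi => ⟨fun v => h.1 v i hi, fun v => h.2 v i hi⟩,
    fun h => ⟨fun v i hi => (h i hi).1 v, fun v i hi => (h i hi).2 v⟩⟩

theorem isSupportedOn_resets (hτ : ∀ i, τ i ∈ siteSupport d ψ i) (M : Op (Cfg d)) :
    IsSupportedOn (partialSupport d ψ S) (resets d ψ τ S M) :=
  isSupportedOn_partialSupport_iff.2 fun i hi => by
    rw [← siteReset_mul_resets (hτ i) hi]
    exact isSupportedOn_siteReset (hτ i) _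

theorem resets_ketbra : resets d ψ τ S (ketbra ψ) = ketbra ψ :=
  Finset.noncommProd_induction _ _ _ (fun R : Module.End ℂ (Op (Cfg d)) => R (ketbra ψ) = ketbra ψ)
    (fun R R' hR hR' => by rw [Module.End.mul_apply, hR', hR]) rfl fun i _ => siteReset_ketbra i

end Resets

/-! ### Commuting preparation maps -/

section SchmidtKraus

variable {N : ℕ} {d : Fin N → ℕ} {ψ : Hilb (Cfg d)} {τ : ∀ i, Hilb (Fin (d i))}
  {S S' : Finset (Fin N)} {α β : Type} {X : α → Op (SubCfg d S)} {X' : β → Op (SubCfg d S')}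

theorem act_ampliate_eq_of_localSupport (hψ : ψ ≠ 0) {Y Z : Op (SubCfg d S)}
    (h : ∀ v ∈ localSupport d ψ, act (ampliate (split d S) Y) v = act (ampliate (split d S) Z) v)
    {v : Hilb (Cfg d)} (hv : v ∈ partialSupport d ψ S) :
    act (ampliate (split d S) Y) v = act (ampliate (split d S) Z) v := by
  rw [← sub_eq_zero, ← act_sub, ← ampliate_sub]
  refine act_eq_zero_of_localSupport hψ (fun i hi B => commute_ampliate_split_single hi _ B)
    (fun u hu => ?_) v hv
  rw [ampliate_sub, act_sub, h u hu, sub_self]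

theorem act_ampliate_comm_of_localSupport (hψ : ψ ≠ 0) {Y : Op (SubCfg d S)}
    {Z : Op (SubCfg d S')}
    (h : ∀ v ∈ localSupport d ψ,
      act (ampliate (split d S) Y) (act (ampliate (split d S') Z) v) =
        act (ampliate (split d S') Z) (act (ampliate (split d S) Y) v))
    {v : Hilb (Cfg d)} (hv : v ∈ partialSupport d ψ (S ∪ S')) :
    act (ampliate (split d S) Y) (act (ampliate (split d S') Z) v) =
      act (ampliate (split d S') Z) (act (ampliate (split d S) Y) v) := by
  simp only [← act_mul] at h ⊢
  rw [← sub_eq_zero, ← act_sub]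
  refine act_eq_zero_of_localSupport hψ (fun i hi B => ?_) (fun u hu => ?_) v hv
  · have hY := commute_ampliate_split_single (fun hS => hi (Finset.mem_union_left S' hS)) Y B
    have hZ := commute_ampliate_split_single (fun hS => hi (Finset.mem_union_right S hS)) Z B
    exact (hY.mul_left hZ).sub_left (hZ.mul_left hY)
  · rw [act_sub, h u hu, sub_self]

theorem act_ampliate_proj_localSupportOn_eq_self_iff {v : Hilb (Cfg d)} :
    act (ampliate (split d S) (proj (localSupportOn d ψ S))) v = v ↔
      v ∈ partialSupport d ψ S := by
  rw [act_ampliate_proj_eq_self_iff, mem_partialSupport_iff_slice]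

theorem act_conditionalKraus_of_mem_partialSupport {v : Hilb (Cfg d)}
    (hv : v ∈ partialSupport d ψ S) (a : Option α) :
    act (ampliate (split d S) (conditionalKraus (proj (localSupportOn d ψ S)) X a)) v =
      a.elim 0 fun a => act (ampliate (split d S) (X a)) v := by
  rw [ampliate_conditionalKraus,
    act_conditionalKraus_of_eq_self (act_ampliate_proj_localSupportOn_eq_self_iff.2 hv)]

variable [Fintype α] [Fintype β]

variable (d ψ S X) in
/-- On the local support, the `X a` are the Kraus operators of a map of the sites in `S` that
fixes `ψ` and whose output lies in the extended Schmidt span of `ψ` on `S`. -/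
structure IsSchmidtKraus : Prop where
  act_mem : ∀ a, ∀ u ∈ localSupportOn d ψ S, act (X a) u ∈ localSupportOn d ψ S
  act_sum_eq_self : ∀ v ∈ localSupport d ψ,
    act (ampliate (split d S) (∑ a, (X a)ᴴ * X a)) v = v
  act_schmidtProj : ∀ a, ∀ v ∈ localSupport d ψ,
    act (schmidtProj d ψ S) (act (ampliate (split d S) (X a)) v) =
      act (ampliate (split d S) (X a)) v
  exists_act_eq_smul : ∀ a, ∃ c : ℂ, act (ampliate (split d S) (X a)) ψ = c • ψ

variable (d ψ S X) in
/-- The map with Kraus operators `X a` where all sites in `S` are locally supported; it does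
nothing elsewhere. -/
def conditionalMap : Module.End ℂ (Op (Cfg d)) :=
  krausMap fun a => ampliate (split d S) (conditionalKraus (proj (localSupportOn d ψ S)) X a)

theorem conditionalMap_apply {M : Op (Cfg d)} (hM : IsSupportedOn (partialSupport d ψ S) M) :
    conditionalMap d ψ S X M = krausMap (fun a => ampliate (split d S) (X a)) M := by
  have hcongr : conditionalMap d ψ S X M = krausMap
      (fun a : Option α => a.elim 0 fun a => ampliate (split d S) (X a)) M := by
    refine hM.krausMap_congr fun a u hu => ?_
    rw [act_conditionalKraus_of_mem_partialSupport hu]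
    cases a <;> simp
  rw [hcongr, krausMap_apply, Fintype.sum_option]
  simp [krausMap_apply]

namespace IsSchmidtKraus

variable (hX : IsSchmidtKraus d ψ S X) (hX' : IsSchmidtKraus d ψ S' X')
include hX

theorem sum_conjTranspose_conditionalKraus_mul (hψ : ψ ≠ 0) :
    ∑ a, (conditionalKraus (proj (localSupportOn d ψ S)) X a)ᴴ *
      conditionalKraus (proj (localSupportOn d ψ S)) X a = 1 := by
  refine QuasiLocal.sum_conjTranspose_conditionalKraus_mul (proj_mul_self _)
    (conjTranspose_proj _) ?_
  obtain ⟨x, -⟩ : ∃ x, ψ x ≠ 0 := by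
    by_contra! h
    exact hψ (PiLp.ext h)
  have : Nonempty (Cfg fun i : {i // ¬ i ∈ S} => d i) := ⟨(split d S x).2⟩
  refine ampliate_injective (split d S) (op_ext fun v => ?_)
  have hv : act (ampliate (split d S) (proj (localSupportOn d ψ S))) v ∈ partialSupport d ψ S :=
    act_ampliate_proj_localSupportOn_eq_self_iff.1 <| by
      rw [← act_mul, ← ampliate_mul, proj_mul_self]
  rw [ampliate_mul, act_mul, act_ampliate_eq_of_localSupport hψ (Z := 1) (fun u hu => ?_) hv,
    ampliate_one, act_one]
  rw [hX.act_sum_eq_self u hu, ampliate_one, act_one]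

theorem isNeighborhoodMap_conditionalMap (hψ : ψ ≠ 0) :
    IsNeighborhoodMap d S (conditionalMap d ψ S X) :=
  isNeighborhoodMap_krausMap (hX.sum_conjTranspose_conditionalKraus_mul hψ)

theorem conditionalMap_ketbra (hψ : ψ ≠ 0) : conditionalMap d ψ S X (ketbra ψ) = ketbra ψ := by
  choose c hc using hX.exists_act_eq_smul
  refine krausMap_ketbra_eq_self (c := fun a => a.elim 0 c) (sum_conjTranspose_ampliate_mul _
    (hX.sum_conjTranspose_conditionalKraus_mul hψ)) fun a => ?_
  rw [act_conditionalKraus_of_mem_partialSupport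
    (localSupport_le_partialSupport S (self_mem_localSupport d ψ))]
  cases a <;> simp [hc]

theorem isSupportedOn_conditionalMap (hψ : ψ ≠ 0) {M : Op (Cfg d)}
    (hM : IsSupportedOn (partialSupport d ψ S) M) :
    IsSupportedOn (partialSupport d ψ S ⊓ fixedSpace (schmidtProj d ψ S))
      (conditionalMap d ψ S X M) := by
  rw [conditionalMap_apply hM]
  refine hM.krausMap fun a u hu =>
    ⟨act_ampliate_mem_partialSupport subset_rfl (hX.act_mem a) hu, ?_⟩
  rw [SetLike.mem_coe, mem_fixedSpace, schmidtProj, ← act_mul, ← ampliate_mul]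
  refine act_ampliate_eq_of_localSupport hψ (fun v hv => ?_) hu
  rw [ampliate_mul, act_mul]
  exact hX.act_schmidtProj a v hv

include hX' in
theorem conditionalMap_comm (hψ : ψ ≠ 0)
    (h : ∀ a b, ∀ v ∈ localSupport d ψ,
      act (ampliate (split d S) (X a)) (act (ampliate (split d S') (X' b)) v) =
        act (ampliate (split d S') (X' b)) (act (ampliate (split d S) (X a)) v))
    {M : Op (Cfg d)} (hM : IsSupportedOn (partialSupport d ψ (S ∪ S')) M) :
    conditionalMap d ψ S X (conditionalMap d ψ S' X' M) =
      conditionalMap d ψ S' X' (conditionalMap d ψ S X M) := by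
  have hSS' : S ⊆ S ∪ S' := Finset.subset_union_left
  have hS'S : S' ⊆ S ∪ S' := Finset.subset_union_right
  rw [conditionalMap_apply (hM.mono (partialSupport_anti hS'S)),
    conditionalMap_apply (hM.mono (partialSupport_anti hSS')), conditionalMap_apply,
    conditionalMap_apply]
  · exact hM.krausMap_comm fun a b u hu => act_ampliate_comm_of_localSupport hψ (h a b) hu
  · exact hM.krausMap fun a u hu =>
      partialSupport_anti hS'S (act_ampliate_mem_partialSupport hSS' (hX.act_mem a) hu)
  · exact hM.krausMap fun b u hu =>
      partialSupport_anti hSS' (act_ampliate_mem_partialSupport hS'S (hX'.act_mem b) hu)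

end IsSchmidtKraus

end SchmidtKraus

section PreparationMap

variable {N : ℕ} {d : Fin N → ℕ} {ψ : Hilb (Cfg d)} {τ : ∀ i, Hilb (Fin (d i))}
  {S S' : Finset (Fin N)} {i : Fin N} {α β : Type} [Fintype α] [Fintype β]
  {X : α → Op (SubCfg d S)} {X' : β → Op (SubCfg d S')}

variable (d ψ τ S X) in
/-- The neighborhood map on `S` that first resets the sites in `S` to their local supports and
then applies the Kraus operators `X a`. -/
def preparationMap : Module.End ℂ (Op (Cfg d)) := conditionalMap d ψ S X * resets d ψ τ S

variable (hψ : ψ ≠ 0) (hτ : ∀ i, τ i ∈ siteSupport d ψ i)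
  (hX : IsSchmidtKraus d ψ S X) (hX' : IsSchmidtKraus d ψ S' X')
include hψ hX

theorem isNeighborhoodMap_preparationMap (hτ : ∀ i, ‖τ i‖ = 1) :
    IsNeighborhoodMap d S (preparationMap d ψ τ S X) :=
  (hX.isNeighborhoodMap_conditionalMap hψ).mul (isNeighborhoodMap_resets hτ)

theorem preparationMap_ketbra : preparationMap d ψ τ S X (ketbra ψ) = ketbra ψ := by
  rw [preparationMap, Module.End.mul_apply, resets_ketbra, hX.conditionalMap_ketbra hψ]

include hτ

theorem isSupportedOn_preparationMap (M : Op (Cfg d)) :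
    IsSupportedOn (partialSupport d ψ S ⊓ fixedSpace (schmidtProj d ψ S))
      (preparationMap d ψ τ S X M) :=
  hX.isSupportedOn_conditionalMap hψ (isSupportedOn_resets hτ M)

theorem commute_preparationMap_siteReset (i : Fin N) :
    Commute (preparationMap d ψ τ S X) (siteReset d ψ τ i) := by
  by_cases hi : i ∈ S
  · have hright : preparationMap d ψ τ S X * siteReset d ψ τ i = preparationMap d ψ τ S X := by
      rw [preparationMap, mul_assoc, resets_mul_siteReset (hτ i) hi]
    have hleft : siteReset d ψ τ i * preparationMap d ψ τ S X = preparationMap d ψ τ S X := by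
      refine LinearMap.ext fun M => ?_
      have hM := (isSupportedOn_preparationMap hψ hτ hX M).mono inf_le_left
      rw [Module.End.mul_apply, siteReset_eq_self (isSupportedOn_partialSupport_iff.1 hM i hi)]
    exact hright.trans hleft.symm
  · exact ((hX.isNeighborhoodMap_conditionalMap hψ).commute_siteReset hi).mul_left
      (commute_siteReset_resets i).symm

include hX' in
theorem commute_preparationMap
    (h : ∀ a b, ∀ v ∈ localSupport d ψ,
      act (ampliate (split d S) (X a)) (act (ampliate (split d S') (X' b)) v) =
        act (ampliate (split d S') (X' b)) (act (ampliate (split d S) (X a)) v)) :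
    Commute (preparationMap d ψ τ S X) (preparationMap d ψ τ S' X') := by
  have hER : Commute (resets d ψ τ S) (preparationMap d ψ τ S' X') :=
    (commute_resets fun i _ => commute_preparationMap_siteReset hψ hτ hX' i).symm
  have hRE : Commute (resets d ψ τ S') (preparationMap d ψ τ S X) :=
    (commute_resets fun i _ => commute_preparationMap_siteReset hψ hτ hX i).symm
  have hRR : Commute (resets d ψ τ S) (resets d ψ τ S') :=
    commute_resets fun i _ => (commute_siteReset_resets i).symm
  have hcond : conditionalMap d ψ S X * conditionalMap d ψ S' X' *
      (resets d ψ τ S * resets d ψ τ S') = conditionalMap d ψ S' X' * conditionalMap d ψ S X *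
      (resets d ψ τ S * resets d ψ τ S') := by
    refine LinearMap.ext fun M => hX.conditionalMap_comm hX' hψ h ?_
    refine isSupportedOn_partialSupport_iff.2 fun i hi => ?_
    rcases Finset.mem_union.1 hi with hi | hi
    · exact isSupportedOn_partialSupport_iff.1 (isSupportedOn_resets hτ _) i hi
    · rw [hRR.eq]
      exact isSupportedOn_partialSupport_iff.1 (isSupportedOn_resets hτ _) i hi
  calc preparationMap d ψ τ S X * preparationMap d ψ τ S' X'
      = conditionalMap d ψ S X * conditionalMap d ψ S' X' *
          (resets d ψ τ S * resets d ψ τ S') := by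
        nth_rw 1 [preparationMap]
        rw [mul_assoc, hER.eq, preparationMap, hRR.eq, mul_assoc, mul_assoc]
    _ = conditionalMap d ψ S' X' * conditionalMap d ψ S X *
          (resets d ψ τ S * resets d ψ τ S') := hcond
    _ = preparationMap d ψ τ S' X' * preparationMap d ψ τ S X := by
        nth_rw 1 [preparationMap]
        rw [mul_assoc _ (resets d ψ τ S'), hRE.eq, preparationMap, mul_assoc, mul_assoc]

end PreparationMap

/-! ### Preparing a product vector factor by factor -/

section FactorReset

theorem act_eq_self_of_act_ampliate_single_prodVec {ι : Type} [Fintype ι] [DecidableEq ι]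
    {m : ι → ℕ} {φ : ∀ j, Hilb (Fin (m j))} (hφ : ∀ j, φ j ≠ 0) {j : ι} {B : Op (Fin (m j))}
    (h : act (ampliate (single m j) B) (prodVec φ) = prodVec φ) : act B (φ j) = φ j := by
  have hzero : prodVec (Function.update φ j (act (B - 1) (φ j))) = 0 := by
    rw [← act_ampliate_single_prodVec, ampliate_sub, act_sub, ampliate_one, act_one, h, sub_self]
  have hprod := norm_prodVec (Function.update φ j (act (B - 1) (φ j)))
  rw [hzero, norm_zero, eq_comm, Finset.prod_eq_zero_iff] at hprod
  obtain ⟨k, -, hk⟩ := hprod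
  rcases eq_or_ne k j with rfl | hkj
  · rw [Function.update_self, norm_eq_zero, act_sub, act_one] at hk
    exact sub_eq_zero.1 hk
  · rw [Function.update_of_ne hkj, norm_eq_zero] at hk
    exact absurd hk (hφ k)

theorem act_ampliate_single_ketBasis_prodVec {ι : Type} [Fintype ι] [DecidableEq ι] {m : ι → ℕ}
    (φ : ∀ j, Hilb (Fin (m j))) (j : ι) (a : Fin (m j)) :
    act (ampliate (single m j) (ketBasis (φ j) a)) (prodVec φ) = φ j a • prodVec φ := by
  have hupdate : Function.update φ j (φ j a • φ j) =
      fun k => Function.update (1 : ι → ℂ) j (φ j a) k • φ k := by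
    funext k
    rcases eq_or_ne k j with rfl | hkj
    · simp
    · simp [hkj]
  rw [act_ampliate_single_prodVec, act_ketBasis, hupdate, prodVec_smul,
    Finset.prod_update_of_mem (Finset.mem_univ j)]
  simp

theorem act_sum_conjTranspose_mul_eq_self {n k α : Type} [Fintype n] [DecidableEq n] [Fintype k]
    [DecidableEq k] [Fintype α] {L : Submodule ℂ (Hilb n)} (W : L ≃ₗᵢ[ℂ] Hilb k)
    {A : α → Op n} {B : α → Op k} (hB : ∑ a, (B a)ᴴ * B a = 1)
    (hA : ∀ a (v : L), act (A a) v = W.symm (act (B a) (W v)))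
    (hA' : ∀ a, ∀ v ∈ L, act (A a)ᴴ v ∈ L) {v : Hilb n} (hv : v ∈ L) :
    act (∑ a, (A a)ᴴ * A a) v = v := by
  have hmem : act (∑ a, (A a)ᴴ * A a) v ∈ L := by
    rw [act_sum]
    refine Submodule.sum_mem _ fun a _ => ?_
    rw [act_mul]
    refine hA' a _ ?_
    rw [hA a ⟨v, hv⟩]
    exact Subtype.prop _
  have hW : ∀ x y : Hilb k, inner ℂ (W.symm x : Hilb n) (W.symm y : Hilb n) = inner ℂ x y :=
    fun x y => (L.subtypeₗᵢ.comp W.symm.toLinearIsometry).inner_map_map x y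
  have hinner : ∀ w ∈ L, inner ℂ w (act (∑ a, (A a)ᴴ * A a) v) = inner ℂ w v := by
    intro w hw
    calc inner ℂ w (act (∑ a, (A a)ᴴ * A a) v)
        = ∑ a, inner ℂ (act (A a) w) (act (A a) v) := by
          simp only [act_sum, inner_sum, act_mul, ← inner_act_left]
      _ = ∑ a, inner ℂ (act (B a) (W ⟨w, hw⟩)) (act (B a) (W ⟨v, hv⟩)) :=
          Finset.sum_congr rfl fun a _ => by rw [hA a ⟨w, hw⟩, hA a ⟨v, hv⟩, hW]
      _ = inner ℂ (W ⟨w, hw⟩) (act (∑ a, (B a)ᴴ * B a) (W ⟨v, hv⟩)) := by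
          simp only [act_sum, inner_sum, act_mul, ← inner_act_left]
      _ = inner ℂ w v := by
          rw [hB, act_one, ← hW, W.symm_apply_apply, W.symm_apply_apply]
  rw [← sub_eq_zero, ← inner_self_eq_zero (𝕜 := ℂ), inner_sub_right,
    hinner _ (Submodule.sub_mem _ hmem hv), sub_self]

variable {N K : ℕ} {d : Fin N → ℕ} {nbhd : Fin K → Finset (Fin N)} {ψ : Hilb (Cfg d)}
  {m : Fin K → ℕ} {W : localSupport d ψ ≃ₗᵢ[ℂ] Hilb (Cfg m)}

theorem IsInducedFactorization.exists_ampliate_mem (hW : IsInducedFactorization d nbhd ψ m W)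
    (j : Fin K) (B : Op (Fin (m j))) : ∃ X : Op (SubCfg d (nbhd j)),
      ampliate (split d (nbhd j)) X ∈ neighborhoodAlgebra d nbhd ψ j ∧
      (∀ u ∈ localSupportOn d ψ (nbhd j), act X u ∈ localSupportOn d ψ (nbhd j)) ∧
      ∀ v : localSupport d ψ, act (ampliate (split d (nbhd j)) X) v =
        W.symm (act (ampliate (single m j) B) (W v)) := by
  obtain ⟨Y, hY⟩ := exists_apply_eq_act (V := localSupport d ψ) W (ampliate (single m j) B)
  obtain ⟨A, hA, hYA⟩ := (hW j Y).2 ⟨B, hY⟩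
  have hA' := hA
  obtain ⟨X, rfl, hX, -⟩ := hA'
  exact ⟨X, hA, hX, fun v => by rw [← hYA, ← hY, W.symm_apply_apply]⟩

theorem IsInducedFactorization.exists_isSchmidtKraus (hW : IsInducedFactorization d nbhd ψ m W)
    (hproj : ∀ j, localSchmidtProj d ψ (nbhd j) ∈ restrictedAlgebra d nbhd ψ j)
    {φ : ∀ j, Hilb (Fin (m j))} (hφ : ∀ j, ‖φ j‖ = 1) (hφψ : prodVec φ = W (localVec d ψ)) :
    ∃ X : ∀ j, Fin (m j) → Op (SubCfg d (nbhd j)),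
      (∀ j, IsSchmidtKraus d ψ (nbhd j) (X j)) ∧
      ∀ j k, j ≠ k → ∀ a b, ∀ v ∈ localSupport d ψ,
        act (ampliate (split d (nbhd j)) (X j a)) (act (ampliate (split d (nbhd k)) (X k b)) v) =
          act (ampliate (split d (nbhd k)) (X k b))
            (act (ampliate (split d (nbhd j)) (X j a)) v) := by
  choose X hXmem hX hXW using fun j a => hW.exists_ampliate_mem j (ketBasis (φ j) a)
  refine ⟨X, fun j => ⟨hX j, fun v hv => ?_, fun a v hv => ?_, fun a => ⟨φ j a, ?_⟩⟩,
    fun j k hjk a b v hv => ?_⟩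
  · simp only [ampliate_sum, ampliate_mul, ampliate_conjTranspose]
    exact act_sum_conjTranspose_mul_eq_self W
      (sum_conjTranspose_ampliate_mul _ (sum_conjTranspose_ketBasis_mul (hφ j))) (hXW j)
      (fun a v hv => act_mem_localSupport (conjTranspose_mem_neighborhoodAlgebra (hXmem j a)) hv) hv
  · obtain ⟨P, hP⟩ := (hW j _).1 (hproj j)
    have hPφ : act P (φ j) = φ j := by
      refine act_eq_self_of_act_ampliate_single_prodVec
        (fun k => norm_ne_zero_iff.1 (by rw [hφ]; exact one_ne_zero)) ?_
      rw [hφψ, ← hP]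
      exact congrArg W (Subtype.ext (act_schmidtProj_self (nbhd j)))
    have hPket : P * ketBasis (φ j) a = ketBasis (φ j) a :=
      op_ext fun v => by rw [act_mul, act_ketBasis, map_smul, hPφ]
    rw [hXW j a ⟨v, hv⟩, ← coe_localSchmidtProj, ← W.symm_apply_apply (localSchmidtProj _ _ _ _),
      hP, W.apply_symm_apply, ← act_mul, ← ampliate_mul, hPket]
  · refine (hXW j a (localVec d ψ)).trans ?_
    rw [← hφψ, act_ampliate_single_ketBasis_prodVec, map_smul, hφψ, W.symm_apply_apply]
    rfl
  · rw [hXW k b ⟨v, hv⟩, hXW j a ⟨v, hv⟩, hXW j a, hXW k b, W.apply_symm_apply,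
      W.apply_symm_apply, act_comm_of_commute (commute_ampliate_single hjk _ _)]

end FactorReset

/-! ### Robust finite-time stabilization by commuting maps -/

section CommutingMaps

theorem applyMaps_eq_of_perm {n : Type} {L L' : List (Module.End ℂ (Op n))}
    (hcomm : ∀ E ∈ L, ∀ E' ∈ L, Commute E E') (h : L.Perm L') (σ : Op n) :
    applyMaps L σ = applyMaps L' σ :=
  h.foldl_eq' (fun E hE E' hE' τ => LinearMap.congr_fun (hcomm E' hE' E hE) τ) σ

theorem Prepares.of_perm {n : Type} [Fintype n] {ρ : Op n} {L L' : List (Module.End ℂ (Op n))}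
    (hL : Prepares L ρ) (hcomm : ∀ E ∈ L, ∀ E' ∈ L, Commute E E') (h : L.Perm L') :
    Prepares L' ρ :=
  fun σ hσ => (applyMaps_eq_of_perm hcomm h σ).symm.trans (hL σ hσ)

theorem exists_applyMaps_eq_apply {n : Type} {L : List (Module.End ℂ (Op n))}
    (hcomm : ∀ E ∈ L, ∀ E' ∈ L, Commute E E') {E : Module.End ℂ (Op n)} (hE : E ∈ L) (σ : Op n) :
    ∃ τ, applyMaps L σ = E τ := by
  classical
  have hperm : L.Perm (L.erase E ++ [E]) :=
    (List.perm_cons_erase hE).trans (List.perm_append_singleton E _).symm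
  exact ⟨applyMaps (L.erase E) σ, by
    rw [applyMaps_eq_of_perm hcomm hperm, applyMaps, List.foldl_append]; rfl⟩

variable {N K : ℕ} {d : Fin N → ℕ} {nbhd : Fin K → Finset (Fin N)} {ψ : Hilb (Cfg d)}
  {L : List (Module.End ℂ (Op (Cfg d)))}

theorem IsDensity.applyMaps (hL : ∀ E ∈ L, ∃ k, IsNeighborhoodMap d (nbhd k) E) {σ : Op (Cfg d)}
    (hσ : IsDensity σ) : IsDensity (applyMaps L σ) := by
  induction L generalizing σ with
  | nil => exact hσ
  | cons E L ih =>
    obtain ⟨k, hE⟩ := hL E List.mem_cons_self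
    exact ih (fun E' hE' => hL E' (List.mem_cons_of_mem E hE')) (hE.isDensity hσ)

theorem IsQLS.prepares (hψ : ‖ψ‖ = 1) (hQLS : IsQLS d nbhd (ketbra ψ))
    (hL : ∀ E ∈ L, ∃ k, IsNeighborhoodMap d (nbhd k) E)
    (hcomm : ∀ E ∈ L, ∀ E' ∈ L, Commute E E')
    (hrange : ∀ k, ∃ E ∈ L, ∀ M, IsSupportedOn (fixedSpace (schmidtProj d ψ (nbhd k))) (E M)) :
    Prepares L (ketbra ψ) := by
  refine fun σ hσ => (hσ.applyMaps hL).eq_ketbra hψ fun v => hQLS.eq_smul hψ fun k => ?_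
  obtain ⟨E, hE, hsupp⟩ := hrange k
  obtain ⟨τ, hτ⟩ := exists_applyMaps_eq_apply hcomm hE σ
  rw [hτ]
  exact mem_fixedSpace.1 ((hsupp τ).1 v)

theorem Prepares.isRFTS {ρ : Op (Cfg d)} (hρ : Prepares L ρ)
    (hL : ∀ E ∈ L, ∃ k, IsNeighborhoodMap d (nbhd k) E) (hfix : ∀ E ∈ L, E ρ = ρ)
    (hcomm : ∀ E ∈ L, ∀ E' ∈ L, Commute E E') : IsRFTS d nbhd ρ := by
  classical
  have hex : ∃ T, Prepares (L.take T) ρ := ⟨L.length, by rwa [List.take_length]⟩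
  set L₀ := L.take (Nat.find hex) with hL₀
  have hmem : ∀ t, L₀.get t ∈ L := fun t => List.mem_of_mem_take (L₀.get_mem t)
  refine ⟨L₀.length, L₀.get, ⟨fun t => hL _ (hmem t), fun t => hfix _ (hmem t), ?_, ?_⟩, ?_⟩
  · rw [List.ofFn_get]
    exact Nat.find_spec hex
  · intro S hS
    have hlt : S < Nat.find hex := hS.trans_le (List.length_take_le _ _)
    rw [List.ofFn_get, hL₀, List.take_take, min_eq_left hlt.le]
    exact Nat.find_min hex hlt
  · intro π
    refine Prepares.of_perm (L := L₀) (Nat.find_spec hex) (fun E hE E' hE' =>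
      hcomm E (List.mem_of_mem_take hE) E' (List.mem_of_mem_take hE')) ?_
    have hperm := (π.ofFn_comp_perm L₀.get).symm
    rwa [List.ofFn_get] at hperm

end CommutingMaps

theorem isRFTS_of_isCompleteFamily {N K : ℕ} {d : Fin N → ℕ} {nbhd : Fin K → Finset (Fin N)}
    {ψ : Hilb (Cfg d)} (hψ : ‖ψ‖ = 1) (hQLS : IsQLS d nbhd (ketbra ψ))
    (hcomm : IsCommutingFamily (restrictedAlgebra d nbhd ψ))
    (hcompl : IsCompleteFamily (restrictedAlgebra d nbhd ψ)) : IsRFTS d nbhd (ketbra ψ) := by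
  have hψ0 : ψ ≠ 0 := norm_ne_zero_iff.1 (hψ ▸ one_ne_zero)
  obtain ⟨m, W, hW⟩ := exists_isInducedFactorization hψ hQLS hcomm hcompl
  obtain ⟨φ, hφ, hφψ⟩ := hW.exists_prodVec hψ hQLS hcomm hcompl
  obtain ⟨X, hX, hXcomm⟩ := hW.exists_isSchmidtKraus (localSchmidtProj_mem hcomm hcompl) hφ hφψ
  choose τ hτ hτ1 using exists_norm_eq_one_mem_siteSupport hψ0
  let E (j : Fin K) := preparationMap d ψ τ (nbhd j) (X j)
  have hE : ∀ j, IsNeighborhoodMap d (nbhd j) (E j) := fun j =>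
    isNeighborhoodMap_preparationMap hψ0 (hX j) hτ1
  have hEcomm : ∀ j k, Commute (E j) (E k) := fun j k => by
    rcases eq_or_ne j k with rfl | hjk
    · exact Commute.refl _
    · exact commute_preparationMap hψ0 hτ (hX j) (hX k) (hXcomm j k hjk)
  have hL : ∀ F ∈ List.ofFn E, ∃ k, IsNeighborhoodMap d (nbhd k) F :=
    List.forall_mem_ofFn_iff.2 fun j => ⟨j, hE j⟩
  have hLcomm : ∀ F ∈ List.ofFn E, ∀ F' ∈ List.ofFn E, Commute F F' :=
    List.forall_mem_ofFn_iff.2 fun j => List.forall_mem_ofFn_iff.2 fun k => hEcomm j k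
  have hprep : Prepares (List.ofFn E) (ketbra ψ) := hQLS.prepares hψ hL hLcomm fun k =>
    ⟨E k, List.mem_ofFn.2 ⟨k, rfl⟩, fun M =>
      (isSupportedOn_preparationMap hψ0 hτ (hX k) M).mono inf_le_right⟩
  exact hprep.isRFTS hL
    (List.forall_mem_ofFn_iff.2 fun j => preparationMap_ketbra hψ0 (hX j)) hLcomm

end QuasiLocal

end

theorem mainTheorem9 {N K : ℕ} (d : Fin N → ℕ) (nbhd : Fin K → Finset (Fin N))
    (ψ : Hilb (Cfg d)) (hψ : ‖ψ‖ = 1)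
    (hQLS : IsQLS d nbhd (ketbra ψ))
    (hcomm : IsCommutingFamily (restrictedAlgebra d nbhd ψ))
    (hcompl : IsCompleteFamily (restrictedAlgebra d nbhd ψ)) :
    (∃ (m : Fin K → ℕ) (W : localSupport d ψ ≃ₗᵢ[ℂ] Hilb (Cfg m)),
      IsInducedFactorization d nbhd ψ m W) ∧
    (∀ (m : Fin K → ℕ) (W : localSupport d ψ ≃ₗᵢ[ℂ] Hilb (Cfg m)),
      IsInducedFactorization d nbhd ψ m W →
        ∃ φ : ∀ j, Hilb (Fin (m j)), (∀ j, ‖φ j‖ = 1) ∧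
          ((W.symm (prodVec φ) : localSupport d ψ) : Hilb (Cfg d)) = ψ) ∧
    IsRFTS d nbhd (ketbra ψ) := by
  refine ⟨exists_isInducedFactorization hψ hQLS hcomm hcompl, fun m W hW => ?_,
    isRFTS_of_isCompleteFamily hψ hQLS hcomm hcompl⟩
  obtain ⟨φ, hφ, hφψ⟩ := hW.exists_prodVec hψ hQLS hcomm hcompl
  refine ⟨φ, hφ, ?_⟩
  rw [hφψ, W.symm_apply_apply]
  rfl
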